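/- **Theorem 3.4.** Let $K\subset\mathbb C$ be an imaginary quadratic field of discriminant $-D$ with $D>4$, ring of integers $\mathcal O$ and class number $h$. Let $\mathfrak f\neq 0$ be an integral ideal of $K$, let $I(\mathfrak f)$ be the group of fractional ideals of $K$ prime to $\mathfrak f$, and let $\epsilon:(\mathcal O/\mathfrak f)^\times\to\mathbb C^\times$ be an odd character, i.e. $\epsilon(-1)=-1$. Let $\chi: I(\mathfrak f)\to\mathbb C^\times$ be an algebraic Hecke character of $K$ of modulus $\mathfrak f$ such that $$\chi(\alpha\mathcal O)=\epsilon(\alpha)\,\alpha\qquad(\ast)$$ for every $\alpha\in K^\times$ prime to $\mathfrak f$. Let $T=K(\chi)$ be the subfield of $\mathbb C$ generated over $K$ by all $\chi(\mathfrak a)$, $\mathfrak a\in I(\mathfrak f)$, and let $T_g\subset T$ be the subfield generated over $K$ by those $\chi(\mathfrak a)$ for which $\mathfrak a^2$ is principal. Let $\mu_n\subset\mathbb C^\times$ be the group of $n$-th roots of unity, and let $\mu_2(\epsilon)$ be the group of elements of $\mathrm{Im}(\epsilon)$ of $2$-power order. Consider the condition $$\mathrm{Im}(\epsilon)\subset\begin{cases}\mu_2&\text{if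 }(6,D)=1,\\ \mu_4&\text{if }2\mid D,\ 3\nmid D,\\ \mu_6&\text{if }3\mid D,\ 2\nmid D,\\ \mu_{12}&\text{if }6\mid D.\end{cases}\qquad(\ast\ast)$$ 1. If $[T:K]=h$, then $(\ast\ast)$ holds. 2. Conversely, if $(\ast\ast)$ holds, then $[T:K]=h$ or $[T:K]=2h$; and for any generator $\xi$ of $\mu_2(\epsilon)$ one has $[T:K]=h$ if and only if $\sqrt{\xi}\notin T_g$. 3. Whether $[T:K]=h$ depends only on $\epsilon$: if $\chi'$ is another algebraic Hecke character of modulus $\mathfrak f$ satisfying $(\ast)$ with the same $\epsilon$, and $T'=K(\chi')$, then $[T:K]=h$ if and only if $[T':K]=h$. -/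

import Mathlib

namespace CMHecke

open NumberField IsDedekindDomain
open scoped nonZeroDivisors

noncomputable section

/-- `I(𝔣)`: the group of fractional ideals of `K` prime to `𝔣`, i.e. those whose order at every
prime dividing `𝔣` is zero. -/
def idealsPrimeTo {K : Type*} [Field K] [NumberField K] (f : Ideal (𝓞 K)) :
    Subgroup (FractionalIdeal (𝓞 K)⁰ K)ˣ where
  carrier := {I | ∀ v : HeightOneSpectrum (𝓞 K), v.asIdeal ∣ f →
    FractionalIdeal.count K v (I : FractionalIdeal (𝓞 K)⁰ K) = 0}
  mul_mem' := by
    intro I J hI hJ v hv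
    rw [Units.val_mul, FractionalIdeal.count_mul K v I.ne_zero J.ne_zero, hI v hv, hJ v hv,
      add_zero]
  one_mem' := by
    intro v _
    rw [Units.val_one, FractionalIdeal.count_one]
  inv_mem' := by
    intro I hI v hv
    rw [Units.val_inv_eq_inv_val, FractionalIdeal.count_inv, hI v hv, neg_zero]

/-- `α ≡ 1 mod* 𝔣`: one has `ord_v (α - 1) ≥ ord_v 𝔣` for every prime `v` dividing `𝔣`, and `α` is
positive at every real embedding of `K`. -/
def IsOneModStar {K : Type*} [Field K] [NumberField K] (f : Ideal (𝓞 K)) (α : Kˣ) : Prop :=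
  (∀ v : HeightOneSpectrum (𝓞 K), v.asIdeal ∣ f →
    v.valuation K ((α : K) - 1) ≤
      WithZero.exp (-FractionalIdeal.count K v (f : FractionalIdeal (𝓞 K)⁰ K))) ∧
  ∀ σ : K →+* ℝ, 0 < σ (α : K)

/-- `α ^ Φ = ∏ σ(α) ^ n_σ` for a formal sum `Φ = ∑ n_σ σ` of complex embeddings of `K`. -/
def typePow {K : Type*} [Field K] [NumberField K] (Φ : (K →+* ℂ) → ℤ) (α : Kˣ) : ℂ :=
  ∏ σ : K →+* ℂ, σ (α : K) ^ Φ σ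

/-- An algebraic Hecke character of `K` of modulus `𝔣` and infinite type `Φ`. -/
structure AlgebraicHeckeCharacter (K : Type*) [Field K] [NumberField K] (f : Ideal (𝓞 K))
    (Φ : (K →+* ℂ) → ℤ) where
  /-- the underlying homomorphism `I(𝔣) → ℂˣ` -/
  toHom : idealsPrimeTo f →* ℂˣ
  map_principal : ∀ (α : Kˣ) (I : idealsPrimeTo f),
    (I : (FractionalIdeal (𝓞 K)⁰ K)ˣ) = toPrincipalIdeal (𝓞 K) K α → IsOneModStar f α →
      ((toHom I : ℂˣ) : ℂ) = typePow Φ α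

/-- `α ∈ Kˣ` is prime to `𝔣` and has residue class `u` in `(𝓞 K / 𝔣)ˣ`: one can write `α = a / b`
with `a`, `b` integral, `b` prime to `𝔣` and `a ≡ u b mod 𝔣`. -/
def HasResidue {K : Type*} [Field K] [NumberField K] (f : Ideal (𝓞 K)) (α : Kˣ)
    (u : (𝓞 K ⧸ f)ˣ) : Prop :=
  ∃ a b : 𝓞 K, IsUnit (Ideal.Quotient.mk f b) ∧ (α : K) * (b : K) = (a : K) ∧
    Ideal.Quotient.mk f a = (u : 𝓞 K ⧸ f) * Ideal.Quotient.mk f b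

/-- `χ(α 𝓞) = ε(α) α` for every principal ideal `α 𝓞` prime to `𝔣`; the field `K` is regarded as a
subfield of `ℂ` by means of `algebraMap K ℂ`. -/
def HasFiniteType {K : Type*} [Field K] [NumberField K] [Algebra K ℂ] {f : Ideal (𝓞 K)}
    {Φ : (K →+* ℂ) → ℤ} (χ : AlgebraicHeckeCharacter K f Φ) (ε : (𝓞 K ⧸ f)ˣ →* ℂˣ) : Prop :=
  ∀ (α : Kˣ) (u : (𝓞 K ⧸ f)ˣ) (I : idealsPrimeTo f),
    (I : (FractionalIdeal (𝓞 K)⁰ K)ˣ) = toPrincipalIdeal (𝓞 K) K α → HasResidue f α u →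
      ((χ.toHom I : ℂˣ) : ℂ) = (ε u : ℂ) * algebraMap K ℂ (α : K)

/-- `K(χ)`: the subfield of `ℂ` generated over `K` by the values of `χ`. -/
def valueField {K : Type*} [Field K] [NumberField K] [Algebra K ℂ] {f : Ideal (𝓞 K)}
    {Φ : (K →+* ℂ) → ℤ} (χ : AlgebraicHeckeCharacter K f Φ) : IntermediateField K ℂ :=
  IntermediateField.adjoin K {z : ℂ | ∃ I : idealsPrimeTo f, z = (χ.toHom I : ℂ)}

/-- `T_g`: the subfield of `ℂ` generated over `K` by the values of `χ` at the ideals prime to `𝔣`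
whose square is principal. -/
def genusField {K : Type*} [Field K] [NumberField K] [Algebra K ℂ] {f : Ideal (𝓞 K)}
    {Φ : (K →+* ℂ) → ℤ} (χ : AlgebraicHeckeCharacter K f Φ) : IntermediateField K ℂ :=
  IntermediateField.adjoin K {z : ℂ | ∃ I : idealsPrimeTo f,
    (∃ α : Kˣ, (I : (FractionalIdeal (𝓞 K)⁰ K)ˣ) ^ 2 = toPrincipalIdeal (𝓞 K) K α) ∧
      z = (χ.toHom I : ℂ)}

/-- `μ_p(ε)`: the elements of `Im ε` whose order is a power of `p`. -/
def muPrimary {G : Type*} [Group G] (p : ℕ) (ε : G →* ℂˣ) : Subgroup ℂˣ where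
  carrier := {x | x ∈ ε.range ∧ ∃ n : ℕ, x ^ p ^ n = 1}
  mul_mem' := by
    rintro x y ⟨hx, m, hm⟩ ⟨hy, n, hn⟩
    refine ⟨mul_mem hx hy, m + n, ?_⟩
    rw [mul_pow, pow_add, pow_mul, hm, one_pow, one_mul, mul_comm (p ^ m), pow_mul, hn, one_pow]
  one_mem' := ⟨one_mem _, 0, one_pow _⟩
  inv_mem' := by
    rintro x ⟨hx, n, hn⟩
    exact ⟨inv_mem hx, n, by rw [inv_pow, hn, inv_one]⟩

/-- The order of the group of roots of unity that has to contain `Im ε`. -/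
def rootOrder (D : ℕ) : ℕ :=
  if Nat.Coprime 6 D then 2
  else if ¬ 3 ∣ D then 4
  else if ¬ 2 ∣ D then 6
  else 12

end

end CMHecke

/-!
# The degree of the field of values of a Hecke character of an imaginary quadratic field

Put `h = classNumber K` and let `A` be the order of the group `Cl[2]` of ideal classes killed by
`2`. Both `T_g` and a field that does not involve `χ` are compared with `A`: the latter,
`selmerField K`, is generated over `K` by all `√α` for which `α 𝓞` is the square of an ideal.

*Kummer theory.* Since the units of `K` are `±1`, the elements `√α` are represented modulo `Kˣ` by
`2 * A` of them, one pair for each class of `Cl[2]`. Elements of a group of radicals that are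
distinct modulo the base field define distinct characters of the monoid of endomorphisms of `ℂ`, so
they are independent by Dedekind's theorem (`linearIndependent_of_div_notMem_range`). Hence
`[selmerField K : K] = 2 * A` (`finrank_selmerField`). The same independence, for the values of `χ`
at representatives of the ideals modulo those with principal square, gives
`[T : K] * A = [T_g : K] * h` (`finrank_valueField_mul`). What has to be known for it is that `χ I`
lies in the abelian extension of `K` generated by `T_g` and all roots of unity only if `I ^ 2` is
principal (`idealClass_sq_eq_one_of_mem`); this holds because `K` contains no roots of unity other
than `±1`.

*Comparison.* Let `ζ` generate the image of `ε` and let `s ^ 2 = ζ`. If `I ^ 2 = α 𝓞`, then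
`χ I ^ 2 = ε(α) α`, so `χ I` is `√α` times a power of `s`. Therefore `selmerField K ≤ T_g(s)`, with
equality if `s ∈ selmerField K` (`selmerField_le_sup`, `sup_le_selmerField`). As `ζ ∈ T_g`, the
degree of `T_g(s)` over `T_g` is `1` or `2`.

If `[T : K] = h`, then `[T_g : K] = A`, so that `T_g(s)` has degree at most `2 * A` and equals
`selmerField K`, which therefore contains `s`. Conversely, if `s ∈ selmerField K`, then
`2 * A = [T_g(s) : T_g] * [T_g : K]`, so that `[T : K]` is `h` or `2 * h` according as `s ∉ T_g` or
`s ∈ T_g`. A generator `ξ` of the `2`-primary part of the image of `ε` is `ζ` times the square of a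
value of `ε` (`exists_eq_mul_sq`), and these values lie in `T_g`, so `ξ` and `ζ` have square roots
in `T_g` simultaneously. Finally, `T_g` depends only on `ε`, because `χ I ^ 2` does for ideals `I`
with principal square.

*Roots of unity.* Since `ε` is odd, `s` has order `2 * e`, where `e` is the order of the image of
`ε`. The condition on that image thus reads `s ∈ selmerField K`
(`dvd_rootOrder_of_mem_selmerField`, `mem_selmerField_of_pow_rootOrder_eq_one`). Indeed, every
endomorphism of `ℂ` acts on `selmerField K` as an involution, which forces `2 * e ∣ 24`; the field
contains `√-1`; and for a prime `p` it contains `√p` or `√-p` if and only if `p 𝓞` is the square of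
an ideal, that is, `p ∣ D` (`dvd_discr_iff_exists_sq_eq`). These facts for `p = 2, 3` decide which
roots of unity of order dividing `24` it contains.
-/

namespace CMHecke

open NumberField IsDedekindDomain
open scoped nonZeroDivisors Matrix

noncomputable section

/-! ### Endomorphisms of an algebraically closed field -/

theorem exists_ringHom_comp_algebraMap_eq {S C D : Type*} [CommRing S] [IsDomain S] [Field C]
    [Field D] [Algebra S C] [FaithfulSMul S C] [Algebra.IsAlgebraic S C] [IsAlgClosed D]
    (ψ : S →+* D) (hψ : Function.Injective ψ) :
    ∃ σ : C →+* D, ∀ x : S, σ (algebraMap S C x) = ψ x := by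
  algebraize [ψ]
  have : FaithfulSMul S D := (faithfulSMul_iff_algebraMap_injective S D).mpr hψ
  have : Module.IsTorsionFree S D := inferInstance
  let l : C →ₐ[S] D := IsAlgClosed.lift
  exact ⟨l.toRingHom, fun x => l.commutes x⟩

/-- An endomorphism of the algebraic closure of `F` inside an algebraically closed field `C`
extends to `C`, also when `C` is transcendental over `F`: it extends to the polynomial ring on a
transcendence basis by acting on coefficients, and `C` is algebraic over that ring. -/
theorem exists_algHom_extending {F C : Type*} [Field F] [Field C] [Algebra F C] [IsAlgClosed C]
    (τ : algebraicClosure F C →ₐ[F] algebraicClosure F C) :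
    ∃ σ : C →ₐ[F] C, ∀ x : algebraicClosure F C, σ x = τ x := by
  obtain ⟨ι, b, hb⟩ := exists_isTranscendenceBasis' (algebraicClosure F C) C
  set S := Algebra.adjoin (algebraicClosure F C) (Set.range b)
  let e : MvPolynomial ι (algebraicClosure F C) ≃ₐ[algebraicClosure F C] S := hb.1.aevalEquiv
  let φ : MvPolynomial ι (algebraicClosure F C) →+* C :=
    (MvPolynomial.aeval b).toRingHom.comp (MvPolynomial.map τ.toRingHom)
  have hφ : Function.Injective φ :=
    Function.Injective.comp (g := MvPolynomial.aeval b) hb.1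
      (MvPolynomial.map_injective _ τ.toRingHom.injective)
  let ψ : S →+* C := φ.comp e.symm.toRingEquiv.toRingHom
  have hψ : Function.Injective ψ := hφ.comp e.symm.injective
  have hψC (x : algebraicClosure F C) : ψ (algebraMap _ S x) = τ x := by
    have : e.symm (algebraMap _ S x) = MvPolynomial.C x := by
      rw [e.symm.commutes]; rfl
    change φ (e.symm (algebraMap _ S x)) = _
    rw [this]
    simp [φ]
  have halg : Algebra.IsAlgebraic S C := hb.isAlgebraic
  obtain ⟨σ, hσ⟩ := exists_ringHom_comp_algebraMap_eq (C := C) ψ hψ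
  have hσ' (x : algebraicClosure F C) : σ x = τ x := by
    rw [← hψC, ← hσ]
    rfl
  refine ⟨{ σ with commutes' := fun r => ?_ }, hσ'⟩
  have := hσ' (algebraMap F _ r)
  rw [τ.commutes] at this
  exact this

theorem exists_algHom_apply_eq {F C : Type*} [Field F] [Field C] [Algebra F C] [IsAlgClosed C]
    {x y : C} (hx : IsIntegral F x) (hy : Polynomial.aeval y (minpoly F x) = 0) :
    ∃ σ : C →ₐ[F] C, σ x = y := by
  have hyi : IsIntegral F y :=
    isAlgebraic_iff_isIntegral.mp ⟨minpoly F x, minpoly.ne_zero hx, hy⟩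
  let x' : algebraicClosure F C := ⟨x, mem_algebraicClosure_iff.mpr hx.isAlgebraic⟩
  let y' : algebraicClosure F C := ⟨y, mem_algebraicClosure_iff.mpr hyi.isAlgebraic⟩
  have hm : minpoly F x' = minpoly F x :=
    (minpoly.algebraMap_eq (A := F) (algebraMap (algebraicClosure F C) C).injective x').symm
  have hy' : Polynomial.aeval y' (minpoly F x') = 0 := by
    apply (algebraMap (algebraicClosure F C) C).injective
    rw [hm, map_zero, ← Polynomial.aeval_algebraMap_apply]
    exact hy
  have : IsAlgClosed (algebraicClosure F C) := (algebraicClosure.isAlgClosure F C).isAlgClosed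
  obtain ⟨τ, hτ⟩ := (IntermediateField.exists_algHom_of_splits_of_aeval
    (F := F) (E := algebraicClosure F C) (K := algebraicClosure F C)
    (fun s => ⟨Algebra.IsIntegral.isIntegral s, IsAlgClosed.splits _⟩) hy')
  obtain ⟨σ, hσ⟩ := exists_algHom_extending τ
  refine ⟨σ, ?_⟩
  rw [show x = (x' : C) from rfl, hσ, hτ]

/-- The elements algebraic over a perfect field `F` that are fixed by all `F`-endomorphisms of an
algebraically closed extension lie in `F`. -/
theorem mem_range_of_forall_algHom_apply_eq {F C : Type*} [Field F] [CharZero F] [Field C]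
    [Algebra F C] [IsAlgClosed C] {x : C} (hx : IsIntegral F x)
    (h : ∀ σ : C →ₐ[F] C, σ x = x) : x ∈ (algebraMap F C).range := by
  rw [← minpoly.natDegree_eq_one_iff]
  have hsep : (minpoly F x).Separable := (minpoly.irreducible hx).separable
  have hcard : Multiset.card ((minpoly F x).aroots C) = (minpoly F x).natDegree := by
    rw [Polynomial.aroots, IsAlgClosed.card_roots_eq_natDegree, Polynomial.natDegree_map]
  have hle : Multiset.card ((minpoly F x).aroots C) ≤ 1 := by
    have hnd : ((minpoly F x).aroots C).Nodup := Polynomial.nodup_aroots_iff_of_splits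
      (minpoly.ne_zero hx) (IsAlgClosed.splits _) |>.mpr hsep
    have hsub : (minpoly F x).aroots C ≤ {x} := by
      refine Multiset.le_iff_subset hnd |>.mpr fun y hy => ?_
      obtain ⟨σ, hσ⟩ := exists_algHom_apply_eq hx (Polynomial.mem_aroots.mp hy).2
      rw [Multiset.mem_singleton, ← hσ, h σ]
    simpa using Multiset.card_le_card hsub
  have := minpoly.natDegree_pos hx
  omega

/-! ### Degrees of radical extensions -/

/-- Elements of a multiplicative group of radicals over `F` are linearly independent as soon as
they are distinct modulo `Fˣ`: by Galois theory they define distinct characters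
`σ ↦ σ(x) / x` of the monoid of `F`-endomorphisms, so Dedekind's independence of characters
applies. -/
theorem linearIndependent_of_div_notMem_range {F C A ι : Type*} [Field F] [CharZero F] [Field C]
    [Algebra F C] [IsAlgClosed C] [CommGroup A] (χ : A →* Cˣ)
    (hint : ∀ a, IsIntegral F (χ a : C))
    (hroot : ∀ a (σ : C →ₐ[F] C), σ (χ a) / χ a ∈ (algebraMap F C).range) (x : ι → A)
    (hx : ∀ i j, i ≠ j → ((χ (x i / x j) : Cˣ) : C) ∉ (algebraMap F C).range) :
    LinearIndependent F (fun i => (χ (x i) : C)) := by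
  let κ (i : ι) : (C →ₐ[F] C) →* C :=
    { toFun := fun σ => σ (χ (x i)) / χ (x i)
      map_one' := by simp
      map_mul' := fun σ τ => by
        obtain ⟨c, hc⟩ := hroot (x i) τ
        have h0 : ((χ (x i) : Cˣ) : C) ≠ 0 := Units.ne_zero _
        have hτ : τ (χ (x i)) = algebraMap F C c * χ (x i) := by
          rw [hc, div_mul_cancel₀ _ h0]
        rw [AlgHom.mul_apply, hτ, map_mul, AlgHom.commutes]
        field_simp }
  have hκ : Function.Injective κ := by
    intro i j hij
    by_contra hne
    refine hx i j hne (mem_range_of_forall_algHom_apply_eq (hint _) fun σ => ?_)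
    have h : σ (χ (x i)) / χ (x i) = σ (χ (x j)) / χ (x j) := DFunLike.congr_fun hij σ
    have h0 : ((χ (x i) : Cˣ) : C) ≠ 0 := Units.ne_zero _
    have h1 : ((χ (x j) : Cˣ) : C) ≠ 0 := Units.ne_zero _
    have h2 : σ ((χ (x j) : Cˣ) : C) ≠ 0 := by simp
    rw [map_div, Units.val_div_eq_div_val, map_div₀]
    field_simp at h ⊢
    rw [h]
  have hli := (linearIndependent_monoidHom (C →ₐ[F] C) C).comp κ hκ
  rw [linearIndependent_iff'] at hli ⊢
  intro s g hg i hi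
  have := hli s (fun i => algebraMap F C (g i) * χ (x i)) (by
    ext σ
    have hσ := congrArg σ hg
    rw [map_sum, map_zero] at hσ
    rw [Finset.sum_apply, Pi.zero_apply, ← hσ]
    refine Finset.sum_congr rfl fun j _ => ?_
    have h0 : ((χ (x j) : Cˣ) : C) ≠ 0 := Units.ne_zero _
    simp only [Pi.smul_apply, Function.comp_apply, smul_eq_mul, Algebra.smul_def, map_mul,
      AlgHom.commutes]
    change _ * (σ (χ (x j)) / χ (x j)) = _
    field_simp) i hi
  rw [mul_eq_zero, or_iff_left (Units.ne_zero _)] at this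
  simpa using this

/-- If a multiplicatively closed set `Y` is covered, up to scalars in `F`, by finitely many
`F`-independent elements `v i` of `Y`, these form a basis of `F(Y)`. -/
theorem adjoin_eq_span_of_linearIndependent {F C ι : Type*} [Field F] [Field C] [Algebra F C]
    [Finite ι] (Y : Submonoid C) (v : ι → C) (hvY : ∀ i, v i ∈ Y)
    (hY : ∀ y ∈ Y, ∃ i, ∃ c : F, y = c • v i) :
    (IntermediateField.adjoin F (Y : Set C)).toSubalgebra.toSubmodule
      = Submodule.span F (Set.range v) := by
  have hspan : (Algebra.adjoin F (Y : Set C)).toSubmodule = Submodule.span F (Set.range v) := by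
    rw [Algebra.adjoin_eq_span, Submonoid.closure_eq]
    apply le_antisymm
    · refine Submodule.span_le.mpr fun y hy => ?_
      obtain ⟨i, c, rfl⟩ := hY y hy
      exact Submodule.smul_mem _ _ (Submodule.subset_span ⟨i, rfl⟩)
    · refine Submodule.span_mono ?_
      rintro _ ⟨i, rfl⟩
      exact hvY i
  have hfin : (Algebra.adjoin F (Y : Set C)).toSubmodule.FG := by
    rw [hspan]
    exact Submodule.fg_span (Set.finite_range v)
  have hint : ∀ y ∈ (Y : Set C), IsAlgebraic F y := fun y hy =>
    (IsIntegral.of_mem_of_fg _ hfin y (Algebra.subset_adjoin hy)).isAlgebraic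
  rw [IntermediateField.adjoin_toSubalgebra_of_isAlgebraic hint, hspan]

theorem finrank_adjoin_eq_card {F C ι : Type*} [Field F] [Field C] [Algebra F C]
    [Finite ι] (Y : Submonoid C) (v : ι → C) (hvY : ∀ i, v i ∈ Y)
    (hY : ∀ y ∈ Y, ∃ i, ∃ c : F, y = c • v i) (hv : LinearIndependent F v) :
    Module.finrank F (IntermediateField.adjoin F (Y : Set C)) = Nat.card ι := by
  have := Fintype.ofFinite ι
  rw [Nat.card_eq_fintype_card, ← finrank_span_eq_card hv,
    ← adjoin_eq_span_of_linearIndependent Y v hvY hY]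
  rfl

theorem linearIndependent_of_le {F C ι : Type*} [Field F] [Field C] [Algebra F C]
    {E E' : IntermediateField F C} (h : E ≤ E') {v : ι → C} (hv : LinearIndependent E' v) :
    LinearIndependent E v := by
  rw [linearIndependent_iff'] at hv ⊢
  intro s g hg i hi
  have := hv s (fun q => IntermediateField.inclusion h (g q)) hg i hi
  simpa using this

theorem finrank_adjoin_eq_mul_card {F C ι : Type*} [Field F] [Field C] [Algebra F C]
    [Finite ι] {E : IntermediateField F C} (Y : Submonoid C)
    (hE : E ≤ IntermediateField.adjoin F (Y : Set C)) (v : ι → C) (hvY : ∀ i, v i ∈ Y)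
    (hY : ∀ y ∈ Y, ∃ i, ∃ c ∈ E, y = c * v i) (hv : LinearIndependent E v) :
    Module.finrank F (IntermediateField.adjoin F (Y : Set C)) =
      Module.finrank F E * Nat.card ι := by
  have hT : (IntermediateField.adjoin E (Y : Set C)).restrictScalars F =
      IntermediateField.adjoin F (Y : Set C) := by
    apply le_antisymm
    · change IntermediateField.adjoin E (Y : Set C) ≤ IntermediateField.extendScalars hE
      rw [IntermediateField.adjoin_le_iff]
      exact IntermediateField.subset_adjoin F _
    · rw [IntermediateField.adjoin_le_iff]
      exact IntermediateField.subset_adjoin E (Y : Set C)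
  rw [← hT, ← finrank_adjoin_eq_card Y v hvY (F := E) _ hv]
  · exact (Module.finrank_mul_finrank F E (IntermediateField.adjoin E (Y : Set C))).symm
  · intro y hy
    obtain ⟨i, c, hc, h⟩ := hY y hy
    exact ⟨i, ⟨c, hc⟩, h⟩

/-! ### Arithmetic of an imaginary quadratic field -/

theorem sq_eq_trace_mul_sub_norm {R S : Type*} [CommRing R] [Nontrivial R] [CommRing S]
    [Algebra R S] (b : Module.Basis (Fin 2) R S) (x : S) :
    x ^ 2 = algebraMap R S (Algebra.trace R S x) * x - algebraMap R S (Algebra.norm R x) := by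
  have h := Matrix.aeval_self_charpoly (Algebra.leftMulMatrix b x)
  rw [Matrix.charpoly_fin_two, ← Algebra.trace_eq_matrix_trace b, ← Algebra.norm_eq_matrix_det b,
    Polynomial.aeval_algHom_apply] at h
  have h' := (injective_iff_map_eq_zero _).mp (Algebra.leftMulMatrix_injective b) _ h
  simp only [map_add, map_sub, map_mul, map_pow, Polynomial.aeval_X, Polynomial.aeval_C] at h'
  linear_combination h'

/-- The discriminant of the order `R[x]` is the discriminant of `S` times a square. -/
theorem exists_trace_sq_sub_norm_eq {R S : Type*} [CommRing R] [Nontrivial R] [CommRing S]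
    [Algebra R S] (b : Module.Basis (Fin 2) R S) (x : S) :
    ∃ k : R, Algebra.trace R S x ^ 2 - 4 * Algebra.norm R x = k ^ 2 * Algebra.discr R b := by
  refine ⟨(b.toMatrix ![1, x]).det, ?_⟩
  have := Module.Free.of_basis b
  have hrank : Module.finrank R S = 2 := by simp [Module.finrank_eq_card_basis b]
  have htr (r : R) : Algebra.trace R S (algebraMap R S r) = 2 * r := by
    rw [Algebra.trace_algebraMap, hrank, nsmul_eq_mul, Nat.cast_ofNat]
  have hv : (⇑b ᵥ* (b.toMatrix ![1, x]).map (algebraMap R S)) = ![1, x] := by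
    ext j
    rw [← b.sum_toMatrix_smul_self ![1, x] j]
    simp [Matrix.vecMul, dotProduct, Algebra.smul_def, mul_comm]
  rw [← Algebra.discr_of_matrix_vecMul, hv, Algebra.discr_def, Matrix.det_fin_two]
  simp only [Algebra.traceMatrix_apply, Algebra.traceForm_apply, Matrix.cons_val_zero,
    Matrix.cons_val_one, one_mul, mul_one]
  rw [← pow_two x, sq_eq_trace_mul_sub_norm b x, map_sub, ← Algebra.smul_def, map_smul, htr,
    ← map_one (algebraMap R S), htr, smul_eq_mul]
  ring

section

variable {K : Type*} [Field K] [NumberField K]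

theorem exists_basis_ringOfIntegers (hK : Module.finrank ℚ K = 2) :
    Nonempty (Module.Basis (Fin 2) ℤ (𝓞 K)) :=
  ⟨Module.finBasisOfFinrankEq ℤ (𝓞 K) (by rw [RingOfIntegers.rank, hK])⟩

theorem trace_sq_sub_norm_eq_int (hK : Module.finrank ℚ K = 2) (x : 𝓞 K) :
    ∃ k : ℤ, Algebra.trace ℤ (𝓞 K) x ^ 2 - 4 * Algebra.norm ℤ x = k ^ 2 * discr K := by
  obtain ⟨b⟩ := exists_basis_ringOfIntegers hK
  rw [← discr_eq_discr K b]
  exact exists_trace_sq_sub_norm_eq b x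

theorem trace_sq_sub_norm_eq_rat (hK : Module.finrank ℚ K = 2) (x : K) :
    ∃ k : ℚ, Algebra.trace ℚ K x ^ 2 - 4 * Algebra.norm ℚ x = k ^ 2 * (discr K : ℚ) := by
  have e : Module.Free.ChooseBasisIndex ℤ (𝓞 K) ≃ Fin 2 := Fintype.equivFinOfCardEq (by
    rw [← Module.finrank_eq_card_chooseBasisIndex, RingOfIntegers.rank, hK])
  obtain ⟨k, hk⟩ := exists_trace_sq_sub_norm_eq ((integralBasis K).reindex e) x
  refine ⟨k, hk.trans ?_⟩
  rw [Module.Basis.coe_reindex, Algebra.discr_reindex, coe_discr]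

variable {D : ℕ}

theorem unit_eq_one_or_neg_one (hK : Module.finrank ℚ K = 2) (hD : discr K = -(D : ℤ))
    (hD4 : 4 < D) (u : (𝓞 K)ˣ) : (u : 𝓞 K) = 1 ∨ (u : 𝓞 K) = -1 := by
  obtain ⟨b⟩ := exists_basis_ringOfIntegers hK
  have hq := sq_eq_trace_mul_sub_norm b (u : 𝓞 K)
  obtain ⟨k, hk⟩ := trace_sq_sub_norm_eq_int hK (u : 𝓞 K)
  have hn : IsUnit (Algebra.norm ℤ (u : 𝓞 K)) := u.isUnit.map _
  rw [hD] at hk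
  have hD4' : (4 : ℤ) < D := by exact_mod_cast hD4
  set t := Algebra.trace ℤ (𝓞 K) (u : 𝓞 K)
  set n := Algebra.norm ℤ (u : 𝓞 K)
  have hk0 : k = 0 ∧ n = 1 := by
    have h1 : k ≠ 0 → 1 ≤ k ^ 2 := fun h => by have := sq_pos_of_ne_zero h; lia
    have h2 : 0 ≤ k ^ 2 * (D : ℤ) := by positivity
    rcases Int.isUnit_iff.mp hn with h | h
    · refine ⟨?_, h⟩
      by_contra hk0
      nlinarith [sq_nonneg t, h1 hk0]
    · nlinarith [sq_nonneg t]
  rw [hk0.1, hk0.2] at hk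
  rw [hk0.2] at hq
  have ht : (t - 2) * (t + 2) = 0 := by linear_combination hk
  rcases mul_eq_zero.mp ht with h | h
  · left
    rw [show t = 2 by lia] at hq
    have : ((u : 𝓞 K) - 1) ^ 2 = 0 := by push_cast [eq_intCast] at hq; linear_combination hq
    exact sub_eq_zero.mp (pow_eq_zero_iff two_ne_zero |>.mp this)
  · right
    rw [show t = -2 by lia] at hq
    have : ((u : 𝓞 K) + 1) ^ 2 = 0 := by push_cast [eq_intCast] at hq; linear_combination hq
    exact eq_neg_of_add_eq_zero_left (pow_eq_zero_iff two_ne_zero |>.mp this)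

theorem eq_one_or_neg_one_of_pow_eq_one (hK : Module.finrank ℚ K = 2) (hD : discr K = -(D : ℤ))
    (hD4 : 4 < D) {x : K} {n : ℕ} (hn : 0 < n) (hx : x ^ n = 1) : x = 1 ∨ x = -1 := by
  have hint : IsIntegral ℤ x := IsIntegral.of_pow hn (hx ▸ isIntegral_one)
  let y : 𝓞 K := ⟨x, hint⟩
  have hy : y ^ n = 1 := by ext; exact hx
  rcases unit_eq_one_or_neg_one hK hD hD4 (Units.ofPowEqOne y n hy hn.ne') with h | h
  · left; exact congrArg (algebraMap (𝓞 K) K) h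
  · right
    have := congrArg (algebraMap (𝓞 K) K) h
    rw [map_neg, map_one] at this
    exact this

theorem neg_one_ne_sq (hK : Module.finrank ℚ K = 2) (hD : discr K = -(D : ℤ))
    (hD4 : 4 < D) (x : K) : x ^ 2 ≠ -1 := by
  intro h
  have h4 : x ^ 4 = 1 := by rw [show 4 = 2 * 2 from rfl, pow_mul, h]; norm_num
  rcases eq_one_or_neg_one_of_pow_eq_one hK hD hD4 (by norm_num) h4 with rfl | rfl <;>
    norm_num at h

theorem eq_or_eq_neg_of_toPrincipalIdeal_eq (hK : Module.finrank ℚ K = 2)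
    (hD : discr K = -(D : ℤ)) (hD4 : 4 < D) {x y : Kˣ}
    (h : toPrincipalIdeal (𝓞 K) K x = toPrincipalIdeal (𝓞 K) K y) : x = y ∨ x = -y := by
  have h' := congrArg (Units.val) h
  rw [coe_toPrincipalIdeal, coe_toPrincipalIdeal,
    FractionalIdeal.spanSingleton_eq_spanSingleton] at h'
  obtain ⟨u, hu⟩ := h'
  rcases unit_eq_one_or_neg_one hK hD hD4 u with h1 | h1
  · left
    ext
    rw [← hu, Units.smul_def, h1, one_smul]
  · right
    ext
    rw [Units.val_neg, ← hu, Units.smul_def, h1, neg_smul, one_smul, neg_neg]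

/-- A generator `α` of the square of an ideal is a square up to a rational factor. Its norm is the
square of the norm `r` of the ideal, so that `(α + r) ^ 2 = α * (tr α + 2 * r)`. -/
theorem exists_sq_eq_mul_rat (hK : Module.finrank ℚ K = 2) (hD : discr K = -(D : ℤ))
    {α : Kˣ} {J : (FractionalIdeal (𝓞 K)⁰ K)ˣ} (hJ : J ^ 2 = toPrincipalIdeal (𝓞 K) K α) :
    ∃ (β : K) (q : ℚ), β ≠ 0 ∧ q ≠ 0 ∧ β ^ 2 = α * (q : K) := by
  have b : Module.Basis (Fin 2) ℚ K := Module.finBasisOfFinrankEq ℚ K hK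
  have hq := sq_eq_trace_mul_sub_norm b (α : K)
  obtain ⟨k, hk⟩ := trace_sq_sub_norm_eq_rat hK (α : K)
  have hn := congrArg (fun I : (FractionalIdeal (𝓞 K)⁰ K)ˣ =>
    FractionalIdeal.absNorm (I : FractionalIdeal (𝓞 K)⁰ K)) hJ
  simp only [coe_toPrincipalIdeal, FractionalIdeal.absNorm_span_singleton, Units.val_pow_eq_pow_val,
    map_pow] at hn
  set t := Algebra.trace ℚ K (α : K)
  set n := Algebra.norm ℚ (α : K)
  set r := FractionalIdeal.absNorm (J : FractionalIdeal (𝓞 K)⁰ K)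
  have hr : r ≠ 0 := fun h => J.ne_zero (FractionalIdeal.absNorm_eq_zero_iff.mp h)
  have hn0 : 0 ≤ n := by
    rw [hD] at hk
    push_cast at hk
    have : 0 ≤ k ^ 2 * (D : ℚ) := by positivity
    nlinarith [sq_nonneg t]
  rw [abs_of_nonneg hn0] at hn
  rw [← hn] at hq
  simp only [eq_ratCast, Rat.cast_pow] at hq
  by_cases h : (α : K) + r = 0
  · refine ⟨r, -r, by exact_mod_cast hr, by simpa using hr, ?_⟩
    rw [eq_neg_of_add_eq_zero_left h]
    push_cast
    ring
  · have hs : ((α : K) + r) ^ 2 = α * ((t + 2 * r : ℚ) : K) := by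
      push_cast
      linear_combination hq
    refine ⟨α + r, t + 2 * r, h, fun h0 => h ?_, hs⟩
    rw [h0, Rat.cast_zero, mul_zero] at hs
    exact pow_eq_zero_iff two_ne_zero |>.mp hs

/-- An endomorphism of an extension of a quadratic field `K` permutes the two conjugates of each
element of `K`, so that its square is the identity on `K`. -/
theorem apply_apply_algebraMap_eq (hK : Module.finrank ℚ K = 2) {L : Type*} [Field L]
    [Algebra K L] (σ : L →+* L) (x : K) : σ (σ (algebraMap K L x)) = algebraMap K L x := by
  have : CharZero L := charZero_of_injective_algebraMap (algebraMap K L).injective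
  have b : Module.Basis (Fin 2) ℚ K := Module.finBasisOfFinrankEq ℚ K hK
  have hq := congrArg (algebraMap K L) (sq_eq_trace_mul_sub_norm b x)
  simp only [eq_ratCast, map_pow, map_sub, map_mul, map_ratCast] at hq
  set z := algebraMap K L x
  have hσ := congrArg σ hq
  simp only [map_pow, map_sub, map_mul, map_ratCast] at hσ
  have : (σ z - z) * (σ z + z - (Algebra.trace ℚ K x : ℚ)) = 0 := by linear_combination hσ - hq
  rcases mul_eq_zero.mp this with h | h
  · rw [sub_eq_zero.mp h, sub_eq_zero.mp h]
  · have h1 : σ z = (Algebra.trace ℚ K x : ℚ) - z := by linear_combination h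
    rw [h1, map_sub, map_ratCast, h1]
    ring

end

/-! ### Fractional ideals -/

section

variable {K : Type*} [Field K] [NumberField K]

omit [NumberField K] in
theorem fractionalIdeal_le_one_of_pow_le_one {J : FractionalIdeal (𝓞 K)⁰ K} {n : ℕ} (hn : 0 < n)
    (h : J ^ n ≤ 1) : J ≤ 1 := by
  intro x hx
  have hxn : x ^ n ∈ J ^ n := by
    change x ^ n ∈ ((J ^ n : FractionalIdeal (𝓞 K)⁰ K) : Submodule (𝓞 K) K)
    rw [FractionalIdeal.coe_pow]
    exact Submodule.pow_mem_pow _ hx n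
  obtain ⟨y, hy⟩ := (FractionalIdeal.mem_one_iff _).mp (h hxn)
  have hint : IsIntegral ℤ x := IsIntegral.of_pow hn (hy ▸ RingOfIntegers.isIntegral_coe y)
  exact (FractionalIdeal.mem_one_iff _).mpr ⟨⟨x, hint⟩, rfl⟩

theorem fractionalIdeal_eq_one_of_pow_eq_one {J : (FractionalIdeal (𝓞 K)⁰ K)ˣ} {n : ℕ}
    (hn : 0 < n) (h : J ^ n = 1) : J = 1 := by
  have h1 (I : (FractionalIdeal (𝓞 K)⁰ K)ˣ) (hI : I ^ n = 1) :
      (I : FractionalIdeal (𝓞 K)⁰ K) ≤ 1 := by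
    apply fractionalIdeal_le_one_of_pow_le_one hn
    rw [← Units.val_pow_eq_pow_val, hI, Units.val_one]
  ext1
  apply le_antisymm (h1 J h)
  have h2 := h1 J⁻¹ (by rw [inv_pow, h, inv_one])
  calc (1 : FractionalIdeal (𝓞 K)⁰ K) = ((J⁻¹ : (FractionalIdeal (𝓞 K)⁰ K)ˣ) :
        FractionalIdeal (𝓞 K)⁰ K) * J := by rw [← Units.val_mul, inv_mul_cancel, Units.val_one]
    _ ≤ 1 * J := mul_le_mul_left h2 _
    _ = J := one_mul _

theorem fractionalIdeal_pow_left_injective {I J : (FractionalIdeal (𝓞 K)⁰ K)ˣ} {n : ℕ}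
    (hn : 0 < n) (h : I ^ n = J ^ n) : I = J := by
  rw [← div_eq_one]
  exact fractionalIdeal_eq_one_of_pow_eq_one hn (by rw [div_pow, h, div_self'])

theorem valuation_eq_exp_neg_count (v : HeightOneSpectrum (𝓞 K)) (α : Kˣ) :
    v.valuation K (α : K) = WithZero.exp (-FractionalIdeal.count K v
      (toPrincipalIdeal (𝓞 K) K α : FractionalIdeal (𝓞 K)⁰ K)) := by
  have hint (r : 𝓞 K) (hr : r ≠ 0) : v.valuation K (algebraMap (𝓞 K) K r) = WithZero.exp
      (-FractionalIdeal.count K v (FractionalIdeal.spanSingleton (𝓞 K)⁰ (algebraMap _ K r))) := by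
    rw [← FractionalIdeal.coeIdeal_span_singleton,
      FractionalIdeal.count_coe K v (by simpa using hr), HeightOneSpectrum.valuation_of_algebraMap,
      HeightOneSpectrum.intValuation_if_neg v hr]
  rw [coe_toPrincipalIdeal]
  obtain ⟨r, s, hs, hrs⟩ := IsFractionRing.div_surjective (A := 𝓞 K) (α : K)
  have hs0 : s ≠ 0 := nonZeroDivisors.ne_zero hs
  have hr0 : r ≠ 0 := by
    rintro rfl
    exact α.ne_zero (by rw [← hrs, map_zero, zero_div])
  have hmul : FractionalIdeal.spanSingleton (𝓞 K)⁰ (α : K) *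
      FractionalIdeal.spanSingleton (𝓞 K)⁰ (algebraMap (𝓞 K) K s) =
      FractionalIdeal.spanSingleton (𝓞 K)⁰ (algebraMap (𝓞 K) K r) := by
    rw [FractionalIdeal.spanSingleton_mul_spanSingleton, ← hrs,
      div_mul_cancel₀ _ (by simpa using hs0)]
  have hα0 : FractionalIdeal.spanSingleton (𝓞 K)⁰ (α : K) ≠ 0 :=
    FractionalIdeal.spanSingleton_ne_zero_iff.mpr α.ne_zero
  have hs0' : FractionalIdeal.spanSingleton (𝓞 K)⁰ (algebraMap (𝓞 K) K s) ≠ 0 :=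
    FractionalIdeal.spanSingleton_ne_zero_iff.mpr (by simpa using hs0)
  have hc := congrArg (FractionalIdeal.count K v) hmul
  rw [FractionalIdeal.count_mul K v hα0 hs0'] at hc
  rw [← hrs, map_div₀, hint r hr0, hint s hs0, ← hc, ← WithZero.exp_sub, hrs]
  congr 1
  ring

/-- If `α` is integral at the primes dividing `f`, some `b ≡ 1 mod f` satisfies `b α ∈ 𝓞 K`. -/
theorem exists_mul_mem_of_valuation_le_one (f : Ideal (𝓞 K)) (α : Kˣ)
    (h : ∀ v : HeightOneSpectrum (𝓞 K), v.asIdeal ∣ f → v.valuation K (α : K) ≤ 1)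
    (hf : f ≠ ⊥) :
    ∃ a b : 𝓞 K, Ideal.Quotient.mk f b = 1 ∧ (α : K) * (b : K) = (a : K) := by
  let J : Ideal (𝓞 K) :=
    { carrier := {b | ∃ a : 𝓞 K, (α : K) * (b : K) = (a : K)}
      add_mem' := by
        rintro x y ⟨a, ha⟩ ⟨b, hb⟩
        exact ⟨a + b, by push_cast; rw [mul_add, ha, hb]⟩
      zero_mem' := ⟨0, by simp⟩
      smul_mem' := by
        rintro c x ⟨a, ha⟩
        refine ⟨c * a, ?_⟩
        rw [smul_eq_mul]
        push_cast
        linear_combination (c : K) * ha }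
  have htop : J ⊔ f = ⊤ := by
    by_contra hne
    obtain ⟨P, hP, hle⟩ := Ideal.exists_le_maximal _ hne
    have hfP : f ≤ P := le_sup_right.trans hle
    let v : HeightOneSpectrum (𝓞 K) := ⟨P, hP.isPrime, fun h0 => hf (le_bot_iff.mp (h0 ▸ hfP))⟩
    obtain ⟨n, d, hnd⟩ := HeightOneSpectrum.exists_primeCompl_mul_eq_of_integer v (α : K)
      (h v (Ideal.dvd_iff_le.mpr hfP))
    exact d.2 (hle (Ideal.mem_sup_left ⟨n, hnd⟩))
  obtain ⟨b, ⟨a, hab⟩, c, hc, hbc⟩ := Submodule.mem_sup.mp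
    ((Ideal.eq_top_iff_one _).mp htop)
  refine ⟨a, b, ?_, hab⟩
  rw [← map_one (Ideal.Quotient.mk f), ← hbc, map_add, Ideal.Quotient.eq_zero_iff_mem.mpr hc,
    add_zero]

theorem exists_hasResidue {f : Ideal (𝓞 K)} (hf : f ≠ ⊥) {α : Kˣ} {I : idealsPrimeTo f}
    (hI : (I : (FractionalIdeal (𝓞 K)⁰ K)ˣ) = toPrincipalIdeal (𝓞 K) K α) :
    ∃ u : (𝓞 K ⧸ f)ˣ, HasResidue f α u := by
  have hval (v : HeightOneSpectrum (𝓞 K)) (hv : v.asIdeal ∣ f) : v.valuation K (α : K) = 1 := by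
    rw [valuation_eq_exp_neg_count, ← hI, I.2 v hv]
    rfl
  obtain ⟨a, b, hb, hab⟩ := exists_mul_mem_of_valuation_le_one f α (fun v hv => (hval v hv).le) hf
  obtain ⟨a', b', hb', hab'⟩ := exists_mul_mem_of_valuation_le_one f α⁻¹ (fun v hv => by
    rw [Units.val_inv_eq_inv_val, map_inv₀, hval v hv, inv_one]) hf
  have hprod : a * a' = b * b' := by
    ext
    push_cast
    have := α.mul_inv
    linear_combination (-(a' : K)) * hab - (α : K) * b * hab' + (b : K) * b' * this
  have ha : Ideal.Quotient.mk f a * Ideal.Quotient.mk f a' = 1 := by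
    rw [← map_mul, hprod, map_mul, hb, hb', one_mul]
  refine ⟨Units.mkOfMulEqOne _ _ ha, a, b, by rw [hb]; exact isUnit_one, hab, ?_⟩
  rw [hb, mul_one, Units.val_mkOfMulEqOne]

/-- Every ideal class contains ideals prime to `f`. -/
theorem exists_mul_mem_idealsPrimeTo {f : Ideal (𝓞 K)} (hf : f ≠ ⊥)
    (J : (FractionalIdeal (𝓞 K)⁰ K)ˣ) :
    ∃ β : Kˣ, J * toPrincipalIdeal (𝓞 K) K β ∈ idealsPrimeTo f := by
  by_cases htop : f = ⊤
  · refine ⟨1, fun v hv => absurd ?_ v.isPrime.ne_top⟩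
    rw [htop, Ideal.dvd_iff_le, top_le_iff] at hv
    exact hv
  obtain ⟨a, I, ha, hI⟩ := FractionalIdeal.exists_eq_spanSingleton_mul
    ((J⁻¹ : (FractionalIdeal (𝓞 K)⁰ K)ˣ) : FractionalIdeal (𝓞 K)⁰ K)
  have hI0 : I ≠ 0 := by
    rintro rfl
    exact (J⁻¹).ne_zero (by rw [hI]; simp)
  obtain ⟨c, hc⟩ := IsDedekindDomain.exists_sup_span_eq (I := I * f) (J := I)
    Ideal.mul_le_left (mul_ne_zero hI0 hf)
  have hc0 : c ≠ 0 := by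
    rintro rfl
    rw [Ideal.span_singleton_zero, sup_bot_eq] at hc
    exact htop (by simpa using mul_left_cancel₀ hI0 (hc.trans (mul_one I).symm))
  obtain ⟨C, hC⟩ : I ∣ Ideal.span {c} := Ideal.dvd_iff_le.mpr (hc ▸ le_sup_right)
  have hcop : f ⊔ C = ⊤ := by
    rw [hC, ← Ideal.mul_sup] at hc
    simpa using mul_left_cancel₀ hI0 (hc.trans (mul_one I).symm)
  have hC0 : C ≠ 0 := by
    rintro rfl
    rw [mul_zero] at hC
    exact hc0 (by simpa using hC)
  have haK : algebraMap (𝓞 K) K a ≠ 0 := by simpa using ha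
  have hcK : algebraMap (𝓞 K) K c ≠ 0 := by simpa using hc0
  refine ⟨Units.mk0 (algebraMap (𝓞 K) K c / algebraMap (𝓞 K) K a) (div_ne_zero hcK haK), ?_⟩
  have hval : ((J * toPrincipalIdeal (𝓞 K) K (Units.mk0 _ (div_ne_zero hcK haK)) :
      (FractionalIdeal (𝓞 K)⁰ K)ˣ) : FractionalIdeal (𝓞 K)⁰ K) = C := by
    apply mul_left_cancel₀ (J⁻¹).ne_zero
    rw [← Units.val_mul, inv_mul_cancel_left, coe_toPrincipalIdeal, hI, Units.val_mk0, mul_assoc,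
      ← FractionalIdeal.coeIdeal_mul, ← hC, FractionalIdeal.coeIdeal_span_singleton,
      FractionalIdeal.spanSingleton_mul_spanSingleton, div_eq_inv_mul]
  intro v hv
  rw [hval, FractionalIdeal.count_coe K v hC0, Nat.cast_eq_zero]
  by_contra hne
  have hvC : v.asIdeal ∣ C := Associates.mk_dvd_mk.mp
    ((Associates.count_ne_zero_iff_dvd hC0 v.irreducible).mp hne |> Associates.mk_dvd_mk.mpr)
  apply v.isPrime.ne_top
  rw [← top_le_iff, ← hcop]
  exact sup_le (Ideal.dvd_iff_le.mp hv) (Ideal.dvd_iff_le.mp hvC)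

/-- The prime `p` ramifies in a quadratic field `K` if and only if `p 𝓞` is the square of an
ideal. -/
theorem dvd_discr_iff_exists_sq_eq (hK : Module.finrank ℚ K = 2) {p : ℕ} (hp : p.Prime) {γ : Kˣ}
    (hγ : (γ : K) = p) : (p : ℤ) ∣ discr K ↔
      ∃ J : (FractionalIdeal (𝓞 K)⁰ K)ˣ, J ^ 2 = toPrincipalIdeal (𝓞 K) K γ := by
  have hpZ : Prime (p : ℤ) := Nat.prime_iff_prime_int.mp hp
  have hnorm : Ideal.absNorm (Ideal.span {(p : 𝓞 K)}) = p ^ 2 := by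
    rw [Ideal.absNorm_span_natCast, RingOfIntegers.rank, hK]
  have hp0 : (p : 𝓞 K) ≠ 0 := by exact_mod_cast hp.ne_zero
  have hmap : (Ideal.span {(p : ℤ)}).map (algebraMap ℤ (𝓞 K)) = Ideal.span {(p : 𝓞 K)} := by
    rw [Ideal.map_span, Set.image_singleton, map_natCast]
  have hγ' : (toPrincipalIdeal (𝓞 K) K γ : FractionalIdeal (𝓞 K)⁰ K) =
      (Ideal.span {(p : 𝓞 K)} : Ideal (𝓞 K)) := by
    rw [coe_toPrincipalIdeal, FractionalIdeal.coeIdeal_span_singleton, hγ, map_natCast]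
  constructor
  · intro hdvd
    have h := (not_dvd_discr_iff_forall_mem K (𝓞 K) hpZ).not_right.mp hdvd
    push Not at h
    obtain ⟨P, hP, hmem, hram⟩ := h
    rw [Int.cast_natCast] at hmem
    have hP0 : P ≠ ⊥ := by
      rintro rfl
      exact hp0 (by simpa using hmem)
    have hover : P.LiesOver (Ideal.span {(p : ℤ)}) :=
      (Ideal.liesOver_span_iff hP.ne_top hpZ).mpr (by simpa using hmem)
    have hsq : Ideal.span {(p : 𝓞 K)} ≤ P ^ 2 := by
      rw [← hmap, ← Ideal.ramificationIdx'_ne_one_iff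
        (by rw [hmap]; exact (Ideal.span_singleton_le_iff_mem P).mpr hmem),
        Ideal.ramificationIdx'_eq_ramificationIdx _ _ (by simpa using hp.ne_zero)]
      exact fun h => hram (Ideal.ramificationIdx_eq_one_iff.mp h)
    obtain ⟨Q, hQ⟩ := Ideal.dvd_iff_le.mpr hsq
    -- Comparing norms: `N(P) ^ 2 * N(Q) = p ^ 2` with `N(P) ≠ 1`.
    have hN := congrArg Ideal.absNorm hQ
    rw [hnorm, map_mul, map_pow] at hN
    have hPp : Ideal.absNorm P ∣ p :=
      (Nat.pow_dvd_pow_iff two_ne_zero).mp (Dvd.intro _ hN.symm)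
    have hP1 : Ideal.absNorm P = p :=
      ((Nat.dvd_prime hp).mp hPp).resolve_left
        fun h => hP.ne_top (Ideal.absNorm_eq_one_iff.mp h)
    rw [hP1] at hN
    have hQ1 : Q = 1 := by
      rw [Ideal.one_eq_top, ← Ideal.absNorm_eq_one_iff]
      exact Nat.eq_of_mul_eq_mul_left (pow_pos hp.pos 2) (by rw [← hN, mul_one])
    refine ⟨FractionalIdeal.mk0 K ⟨P, mem_nonZeroDivisors_of_ne_zero hP0⟩, ?_⟩
    ext1
    rw [Units.val_pow_eq_pow_val, FractionalIdeal.coe_mk0, hγ', hQ, hQ1, mul_one,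
      FractionalIdeal.coeIdeal_pow]
  · rintro ⟨J, hJ⟩
    have hJ1 : (J : FractionalIdeal (𝓞 K)⁰ K) ≤ 1 := by
      apply fractionalIdeal_le_one_of_pow_le_one two_pos
      rw [← Units.val_pow_eq_pow_val, hJ, hγ']
      exact FractionalIdeal.coeIdeal_le_one
    obtain ⟨I, hI⟩ := FractionalIdeal.le_one_iff_exists_coeIdeal.mp hJ1
    have hI2 : I ^ 2 = Ideal.span {(p : 𝓞 K)} := by
      apply FractionalIdeal.coeIdeal_injective (K := K)
      change ((I ^ 2 : Ideal (𝓞 K)) : FractionalIdeal (𝓞 K)⁰ K) = _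
      rw [FractionalIdeal.coeIdeal_pow, hI, ← Units.val_pow_eq_pow_val, hJ, hγ']
    have hIn : Ideal.absNorm I = p := by
      rw [← hI2, map_pow] at hnorm
      exact Nat.pow_left_injective two_ne_zero hnorm
    obtain ⟨P, hP, -, hPI⟩ := Ideal.exists_isMaximal_dvd_of_dvd_absNorm' hp I hIn.symm.dvd
    have hmax : (Ideal.span {(p : ℤ)}).IsMaximal :=
      ((Ideal.span_singleton_prime hpZ.ne_zero).mpr hpZ).isMaximal (by simpa using hp.ne_zero)
    have hdiff := pow_sub_one_dvd_differentIdeal ℤ (p := Ideal.span {(p : ℤ)}) P 2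
      (by simpa using hp.ne_zero) (by rw [hmap, ← hI2]; exact pow_dvd_pow_of_dvd hPI 2)
    rw [Nat.add_one_sub_one, pow_one] at hdiff
    by_contra hnd
    refine dvd_differentIdeal_iff.mp hdiff
      ((not_dvd_discr_iff_forall_mem K (𝓞 K) hpZ).mp hnd P hP.isPrime ?_)
    have : (p : 𝓞 K) ∈ I ^ 2 := hI2 ▸ Ideal.mem_span_singleton_self _
    rw [Int.cast_natCast]
    exact Ideal.dvd_iff_le.mp hPI (Ideal.pow_le_self two_ne_zero this)

end

/-! ### The field generated by the square roots of generators of squares of ideals -/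

theorem classGroup_mk_eq_one_iff {K : Type*} [Field K] [NumberField K]
    {I : (FractionalIdeal (𝓞 K)⁰ K)ˣ} :
    ClassGroup.mk K I = 1 ↔ ∃ α : Kˣ, I = toPrincipalIdeal (𝓞 K) K α := by
  rw [← (ClassGroup.equiv K).injective.eq_iff]
  simp only [ClassGroup.equiv_mk, FractionalIdeal.canonicalEquiv_self,
    RingEquiv.coe_mulEquiv_refl, QuotientGroup.mk'_apply, map_one, QuotientGroup.eq_one_iff,
    MonoidHom.mem_range, Units.ext_iff, Units.coe_mapEquiv, MulEquiv.refl_apply]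
  exact exists_congr fun _ => eq_comm

theorem classGroup_mk_surjective (K : Type*) [Field K] [NumberField K] :
    Function.Surjective (ClassGroup.mk (R := 𝓞 K) K) := fun c => by
  obtain ⟨I, rfl⟩ := ClassGroup.mk0_surjective c
  exact ⟨FractionalIdeal.mk0 K I, ClassGroup.mk_mk0 K I⟩

/-- The group `Cl[2]` of ideal classes of order dividing `2`. -/
abbrev twoTorsionClasses (K : Type*) [Field K] [NumberField K] : Subgroup (ClassGroup (𝓞 K)) :=
  (powMonoidHom 2).ker

theorem mem_twoTorsionClasses {K : Type*} [Field K] [NumberField K] {c : ClassGroup (𝓞 K)} :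
    c ∈ twoTorsionClasses K ↔ c ^ 2 = 1 := Iff.rfl

theorem toPrincipalIdeal_neg_one (K : Type*) [Field K] [NumberField K] :
    toPrincipalIdeal (𝓞 K) K (-1) = 1 := by
  rw [← map_one (toPrincipalIdeal (𝓞 K) K)]
  ext1
  rw [coe_toPrincipalIdeal, coe_toPrincipalIdeal, FractionalIdeal.spanSingleton_eq_spanSingleton]
  exact ⟨-1, by simp [Units.smul_def]⟩

section

variable {K : Type*} [Field K] [NumberField K] [Algebra K ℂ]

variable (K) in
/-- The square roots in `ℂ` of those `α ∈ Kˣ` for which `α 𝓞` is the square of an ideal. -/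
def selmerRoots : Submonoid ℂ where
  carrier := {y | ∃ (α : Kˣ) (J : (FractionalIdeal (𝓞 K)⁰ K)ˣ),
    J ^ 2 = toPrincipalIdeal (𝓞 K) K α ∧ y ^ 2 = algebraMap K ℂ α}
  mul_mem' := by
    rintro x y ⟨α, I, hI, hx⟩ ⟨β, J, hJ, hy⟩
    exact ⟨α * β, I * J, by rw [mul_pow, hI, hJ, map_mul], by
      rw [mul_pow, hx, hy, Units.val_mul, map_mul]⟩
  one_mem' := ⟨1, 1, by simp, by simp⟩

variable (K) in
/-- The field generated over `K` by the square roots of those `α ∈ Kˣ` for which `α 𝓞` is the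
square of an ideal. -/
def selmerField : IntermediateField K ℂ :=
  IntermediateField.adjoin K (selmerRoots K : Set ℂ)

theorem linearIndependent_of_sq_mem {ι : Type*} (x : ι → ℂˣ)
    (hsq : ∀ i, ∃ α : Kˣ, (x i : ℂ) ^ 2 = algebraMap K ℂ α)
    (hx : ∀ i j, i ≠ j → ((x i / x j : ℂˣ) : ℂ) ∉ (algebraMap K ℂ).range) :
    LinearIndependent K (fun i => (x i : ℂ)) := by
  let A : Subgroup ℂˣ := ((Units.map (algebraMap K ℂ).toMonoidHom).range).comap (powMonoidHom 2)
  have hA (a : A) : ∃ α : Kˣ, ((a : ℂˣ) : ℂ) ^ 2 = algebraMap K ℂ α := by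
    obtain ⟨α, hα⟩ := a.2
    exact ⟨α, (congrArg Units.val hα).symm⟩
  have hx' (i : ι) : x i ∈ A := by
    obtain ⟨α, hα⟩ := hsq i
    exact ⟨α, Units.ext hα.symm⟩
  refine linearIndependent_of_div_notMem_range A.subtype (fun a => ?_) (fun a σ => ?_)
    (fun i => ⟨x i, hx' i⟩) hx
  · obtain ⟨α, hα⟩ := hA a
    exact IsIntegral.of_pow two_pos (hα ▸ isIntegral_algebraMap)
  · obtain ⟨α, hα⟩ := hA a
    have h0 : ((a : ℂˣ) : ℂ) ≠ 0 := Units.ne_zero _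
    have h1 : σ ((a : ℂˣ) : ℂ) ^ 2 = ((a : ℂˣ) : ℂ) ^ 2 := by
      rw [← map_pow, hα, AlgHom.commutes]
    rcases sq_eq_sq_iff_eq_or_eq_neg.mp h1 with h | h
    · exact ⟨1, by rw [Subgroup.subtype_apply, h, div_self h0, map_one]⟩
    · exact ⟨-1, by rw [Subgroup.subtype_apply, h, neg_div, div_self h0, map_neg, map_one]⟩

theorem mul_mem_selmerRoots {y : ℂ} (hy : y ∈ selmerRoots K) (k : Kˣ) :
    algebraMap K ℂ k * y ∈ selmerRoots K := by
  obtain ⟨α, J, hJ, hy⟩ := hy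
  refine ⟨k ^ 2 * α, toPrincipalIdeal (𝓞 K) K k * J, ?_, ?_⟩
  · rw [mul_pow, hJ, map_mul, map_pow]
  · rw [mul_pow, hy, Units.val_mul, map_mul, Units.val_pow_eq_pow_val, map_pow]

variable {D : ℕ}

/-- Up to `Kˣ`, the elements of `selmerRoots K` are represented by an independent family indexed
by `Cl[2] × {0, 1}`: a square root of a generator of `J ^ 2` for each class of `Cl[2]`, and its
product with `√-1`. -/
theorem exists_basis_selmerRoots (hK : Module.finrank ℚ K = 2) (hD : discr K = -(D : ℤ))
    (hD4 : 4 < D) : ∃ v : twoTorsionClasses K × Bool → ℂˣ,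
      (∀ i, (v i : ℂ) ∈ selmerRoots K) ∧
      (∀ i j, i ≠ j → ((v i / v j : ℂˣ) : ℂ) ∉ (algebraMap K ℂ).range) ∧
      ∀ y ∈ selmerRoots K, ∃ i, ∃ k : Kˣ, y = algebraMap K ℂ k * v i := by
  have hex (c : twoTorsionClasses K) : ∃ (J : (FractionalIdeal (𝓞 K)⁰ K)ˣ) (α : Kˣ) (y : ℂˣ),
      ClassGroup.mk K J = c ∧ J ^ 2 = toPrincipalIdeal (𝓞 K) K α ∧
      (y : ℂ) ^ 2 = algebraMap K ℂ α := by
    obtain ⟨J, hJ⟩ := classGroup_mk_surjective K c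
    have h1 : ClassGroup.mk K (J ^ 2) = 1 := by
      rw [map_pow, hJ]
      exact mem_twoTorsionClasses.mp c.2
    obtain ⟨α, hα⟩ := classGroup_mk_eq_one_iff.mp h1
    obtain ⟨y, hy⟩ := IsAlgClosed.exists_pow_nat_eq (algebraMap K ℂ α) two_pos
    have hy0 : y ≠ 0 := by
      rintro rfl
      have : algebraMap K ℂ α = 0 := by rw [← hy]; norm_num
      simp at this
    exact ⟨J, α, Units.mk0 y hy0, hJ, hα, hy⟩
  choose J α y hJc hJα hy using hex
  let iu : ℂˣ := Units.mk0 Complex.I Complex.I_ne_zero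
  have hiu : (iu : ℂ) ^ 2 = -1 := Complex.I_sq
  have hmk (I I' : (FractionalIdeal (𝓞 K)⁰ K)ˣ) (k : Kˣ)
      (h : I ^ 2 = (toPrincipalIdeal (𝓞 K) K k * I') ^ 2) :
      ClassGroup.mk K I = ClassGroup.mk K I' := by
    rw [fractionalIdeal_pow_left_injective two_pos h, map_mul,
      classGroup_mk_eq_one_iff.mpr ⟨k, rfl⟩, one_mul]
  have hI (k : K) : algebraMap K ℂ k ≠ Complex.I := by
    intro h
    refine neg_one_ne_sq hK hD hD4 k ((algebraMap K ℂ).injective ?_)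
    rw [map_pow, h, Complex.I_sq, map_neg, map_one]
  refine ⟨fun i => y i.1 * (if i.2 then iu else 1), ?_, ?_, ?_⟩
  · rintro ⟨c, b⟩
    have hyc : ((y c : ℂˣ) : ℂ) ∈ selmerRoots K := ⟨α c, J c, hJα c, hy c⟩
    cases b
    · simpa using hyc
    · rw [Units.val_mul]
      have hiY : (iu : ℂ) ∈ selmerRoots K :=
        ⟨-1, 1, by rw [one_pow, toPrincipalIdeal_neg_one], by simpa using hiu⟩
      exact mul_mem hyc hiY
  · rintro ⟨c, b⟩ ⟨c', b'⟩ hne ⟨k, hk⟩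
    have hk0 : k ≠ 0 := by
      rintro rfl
      rw [map_zero] at hk
      exact Units.ne_zero _ hk.symm
    have hmul : ((y c : ℂˣ) : ℂ) * ((if b then iu else 1 : ℂˣ) : ℂ) =
        algebraMap K ℂ k * (y c' * ((if b' then iu else 1 : ℂˣ) : ℂ)) := by
      rw [hk, ← Units.val_mul, ← Units.val_mul, ← Units.val_mul, div_mul_cancel]
    have hc : c = c' := by
      have hs := congrArg (· ^ 2) hmul
      simp only [mul_pow, hy] at hs
      have hsq (b : Bool) : ∃ e : Kˣ, (((if b then iu else 1 : ℂˣ) : ℂ)) ^ 2 = algebraMap K ℂ e ∧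
          toPrincipalIdeal (𝓞 K) K e = 1 := by
        cases b
        · exact ⟨1, by simp, by simp⟩
        · exact ⟨-1, by simpa using hiu, toPrincipalIdeal_neg_one K⟩
      obtain ⟨e, he, he1⟩ := hsq b
      obtain ⟨e', he', he1'⟩ := hsq b'
      rw [he, he', ← map_mul, ← map_mul, ← map_pow, ← map_mul] at hs
      have hs' : α c * e = Units.mk0 k hk0 ^ 2 * (α c' * e') :=
        Units.ext ((algebraMap K ℂ).injective hs)
      have hp := congrArg (toPrincipalIdeal (𝓞 K) K) hs'
      rw [map_mul, map_mul, map_mul, map_pow, he1, he1', mul_one, mul_one, ← hJα, ← hJα,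
        ← mul_pow] at hp
      exact Subtype.ext (by rw [← hJc c, ← hJc c', hmk _ _ _ hp])
    subst hc
    have hb : b ≠ b' := fun h => hne (by rw [h])
    have h0 : ((y c : ℂˣ) : ℂ) ≠ 0 := Units.ne_zero _
    have hmul' : ((if b then iu else 1 : ℂˣ) : ℂ) =
        algebraMap K ℂ k * ((if b' then iu else 1 : ℂˣ) : ℂ) := by
      apply mul_left_cancel₀ h0
      rw [hmul]
      ring
    cases b <;> cases b'
    · exact hb rfl
    · have h1 : (1 : ℂ) = algebraMap K ℂ k * Complex.I := by simpa [iu] using hmul'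
      refine hI (-k) ?_
      rw [map_neg]
      linear_combination -Complex.I * h1 - algebraMap K ℂ k * Complex.I_sq
    · exact hI k (by simpa [iu] using hmul'.symm)
    · exact hb rfl
  · rintro x ⟨β, I, hIβ, hx⟩
    have hI1 : ClassGroup.mk K I ∈ twoTorsionClasses K := by
      rw [mem_twoTorsionClasses, ← map_pow, hIβ]
      exact classGroup_mk_eq_one_iff.mpr ⟨β, rfl⟩
    set c : twoTorsionClasses K := ⟨_, hI1⟩
    have hcI : ClassGroup.mk K ((J c)⁻¹ * I) = 1 := by
      rw [map_mul, map_inv, hJc c, inv_mul_cancel]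
    obtain ⟨k, hk⟩ := classGroup_mk_eq_one_iff.mp hcI
    have hp : toPrincipalIdeal (𝓞 K) K β = toPrincipalIdeal (𝓞 K) K (α c * k ^ 2) := by
      rw [map_mul, map_pow, ← hk, ← hIβ, ← hJα, ← mul_pow, mul_inv_cancel_left]
    have h0 : ((y c : ℂˣ) : ℂ) ≠ 0 := Units.ne_zero _
    rcases eq_or_eq_neg_of_toPrincipalIdeal_eq hK hD hD4 hp with h | h
    · have hs : x ^ 2 = (algebraMap K ℂ k * y c) ^ 2 := by
        rw [hx, mul_pow, hy, h, Units.val_mul, map_mul, Units.val_pow_eq_pow_val, map_pow,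
          mul_comm]
      rcases sq_eq_sq_iff_eq_or_eq_neg.mp hs with h | h
      · exact ⟨(c, false), k, by simpa using h⟩
      · exact ⟨(c, false), -k, by simpa using h⟩
    · have hs : x ^ 2 = (algebraMap K ℂ k * (y c * iu)) ^ 2 := by
        rw [hx, mul_pow, mul_pow, hy, hiu, h, Units.val_neg, map_neg, Units.val_mul, map_mul,
          Units.val_pow_eq_pow_val, map_pow]
        ring
      rcases sq_eq_sq_iff_eq_or_eq_neg.mp hs with h | h
      · exact ⟨(c, true), k, by simpa using h⟩
      · exact ⟨(c, true), -k, by simpa using h⟩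

theorem finrank_selmerField (hK : Module.finrank ℚ K = 2) (hD : discr K = -(D : ℤ))
    (hD4 : 4 < D) : Module.finrank K (selmerField K) = 2 * Nat.card (twoTorsionClasses K) := by
  obtain ⟨v, hv, hdiv, hspan⟩ := exists_basis_selmerRoots (K := K) hK hD hD4
  rw [selmerField, finrank_adjoin_eq_card _ (fun i => (v i : ℂ)) hv
    (fun y hy => ?_) (linearIndependent_of_sq_mem v (fun i => ?_) hdiv), Nat.card_prod,
    Nat.card_eq_fintype_card (α := Bool), Fintype.card_bool, mul_comm]
  · obtain ⟨i, k, h⟩ := hspan y hy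
    exact ⟨i, k, by rw [h, Algebra.smul_def]⟩
  · obtain ⟨α, -, -, h⟩ := hv i
    exact ⟨α, h⟩

theorem mem_selmerField {y : ℂ} (hy : y ∈ selmerRoots K) : y ∈ selmerField K :=
  IntermediateField.subset_adjoin K _ hy

/-- Kummer theory: an element of `selmerField K` whose square `α` lies in `K` is one of the given
square roots up to `Kˣ`, as otherwise it would be independent of them. -/
theorem exists_sq_eq_of_mem_selmerField (hK : Module.finrank ℚ K = 2) (hD : discr K = -(D : ℤ))
    (hD4 : 4 < D) {y : ℂ} (hy : y ∈ selmerField K) {α : Kˣ} (hα : y ^ 2 = algebraMap K ℂ α) :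
    ∃ J : (FractionalIdeal (𝓞 K)⁰ K)ˣ, J ^ 2 = toPrincipalIdeal (𝓞 K) K α := by
  obtain ⟨v, hv, hdiv, hspan⟩ := exists_basis_selmerRoots (K := K) hK hD hD4
  have hy0 : y ≠ 0 := by
    rintro rfl
    have : algebraMap K ℂ α = 0 := by rw [← hα]; norm_num
    simp at this
  by_cases hex : ∃ i, y / v i ∈ (algebraMap K ℂ).range
  · obtain ⟨i, k, hk⟩ := hex
    have hyk : y = algebraMap K ℂ k * v i := by
      rw [hk, div_mul_cancel₀ _ (Units.ne_zero _)]
    have hk0 : k ≠ 0 := by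
      rintro rfl
      exact hy0 (by rw [hyk, map_zero, zero_mul])
    obtain ⟨β, J, hJ, hβ⟩ := mul_mem_selmerRoots (hv i) (Units.mk0 k hk0)
    rw [Units.val_mk0, ← hyk, hα] at hβ
    exact ⟨J, by rw [hJ, Units.ext ((algebraMap K ℂ).injective hβ)]⟩
  · exfalso
    push Not at hex
    have hmem : y ∈ Submodule.span K (Set.range fun i => (v i : ℂ)) := by
      rw [← adjoin_eq_span_of_linearIndependent (selmerRoots K) (fun i => (v i : ℂ)) hv]
      · exact hy
      · intro y hy
        obtain ⟨i, k, h⟩ := hspan y hy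
        exact ⟨i, k, by rw [h, Algebra.smul_def]⟩
    have hli := linearIndependent_of_sq_mem (K := K)
      (fun o : Option (twoTorsionClasses K × Bool) => o.elim (Units.mk0 y hy0) v) (by
        rintro (_ | i)
        · exact ⟨α, hα⟩
        · obtain ⟨α, -, -, h⟩ := hv i
          exact ⟨α, h⟩) (by
        rintro (_ | i) (_ | j) hij
        · exact absurd rfl hij
        · simpa [Units.val_div_eq_div_val] using hex j
        · rintro ⟨k, hk⟩
          refine hex i ⟨k⁻¹, ?_⟩
          rw [map_inv₀, hk]
          simp [Units.val_div_eq_div_val]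
        · exact hdiv i j (fun h => hij (by rw [h])))
    have := (linearIndependent_option.mp hli).2
    exact this hmem

/-- Every endomorphism of `ℂ` acts on `selmerField K` as an involution: by
`exists_sq_eq_mul_rat` this field is generated by `K` and square roots of rational numbers. -/
theorem apply_apply_eq_of_mem_selmerField (hK : Module.finrank ℚ K = 2)
    (hD : discr K = -(D : ℤ)) (σ : ℂ →+* ℂ) {x : ℂ} (hx : x ∈ selmerField K) :
    σ (σ x) = x := by
  induction hx using IntermediateField.adjoin_induction with
  | mem y hy =>
    obtain ⟨α, J, hJ, hyα⟩ := hy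
    obtain ⟨β, q, hβ0, hq0, hβ⟩ := exists_sq_eq_mul_rat hK hD hJ
    have hα0 : algebraMap K ℂ α ≠ 0 := by simp
    have hβ0' : algebraMap K ℂ β ≠ 0 := by simpa using hβ0
    have hy0 : y ≠ 0 := by
      rintro rfl
      exact hα0 (by rw [← hyα]; norm_num)
    have hz : (algebraMap K ℂ β / y) ^ 2 = q := by
      rw [div_pow, hyα, ← map_pow, hβ, map_mul, map_ratCast, mul_div_cancel_left₀ _ hα0]
    have hσz : σ (σ (algebraMap K ℂ β / y)) = algebraMap K ℂ β / y := by
      have h1 : σ (algebraMap K ℂ β / y) ^ 2 = (algebraMap K ℂ β / y) ^ 2 := by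
        rw [← map_pow, hz, map_ratCast]
      rcases sq_eq_sq_iff_eq_or_eq_neg.mp h1 with h | h
      · rw [h, h]
      · rw [h, map_neg, h, neg_neg]
    rw [map_div₀, map_div₀, apply_apply_algebraMap_eq hK] at hσz
    have hσy : σ (σ y) ≠ 0 := by simpa using hy0
    field_simp at hσz
    exact hσz.symm
  | algebraMap x => exact apply_apply_algebraMap_eq hK σ x
  | add x y _ _ hx hy => rw [map_add, map_add, hx, hy]
  | inv x _ hx => rw [map_inv₀, map_inv₀, hx]
  | mul x y _ _ hx hy => rw [map_mul, map_mul, hx, hy]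

theorem dvd_twentyFour_of_forall_sq_eq_one {n : ℕ} (hn : 0 < n)
    (h : ∀ u : (ZMod n)ˣ, u ^ 2 = 1) : n ∣ 24 := by
  have := NeZero.of_pos hn
  by_cases h5 : 5 ∣ n
  · exfalso
    obtain ⟨u, hu⟩ := ZMod.unitsMap_surjective h5 (Units.mkOfMulEqOne (2 : ZMod 5) 3 (by decide))
    have h2 := congrArg (ZMod.unitsMap h5) (h u)
    rw [map_pow, hu, map_one, Units.ext_iff] at h2
    revert h2
    decide
  · have hc : Nat.Coprime 5 n := (Nat.Prime.coprime_iff_not_dvd (by norm_num)).mpr h5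
    have h1 := congrArg Units.val (h (ZMod.unitOfCoprime 5 hc))
    rw [Units.val_pow_eq_pow_val, ZMod.coe_unitOfCoprime, Units.val_one, ← sub_eq_zero] at h1
    have h2 : ((24 : ℕ) : ZMod n) = 0 := by
      rw [← h1]
      push_cast
      norm_num
    exact (ZMod.natCast_eq_zero_iff _ _).mp h2

theorem dvd_twentyFour_of_mem_selmerField (hK : Module.finrank ℚ K = 2)
    (hD : discr K = -(D : ℤ)) {ζ : ℂ} {n : ℕ} (hn : 0 < n) (hζ : IsPrimitiveRoot ζ n)
    (hmem : ζ ∈ selmerField K) : n ∣ 24 := by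
  refine dvd_twentyFour_of_forall_sq_eq_one hn fun u => ?_
  have := NeZero.of_pos hn
  set t : ℕ := (u : ZMod n).val
  have ht : Nat.Coprime t n := ZMod.val_coe_unit_coprime u
  have hζt : IsPrimitiveRoot (ζ ^ t) n := hζ.pow_of_coprime t ht
  obtain ⟨σ, hσ⟩ := exists_algHom_apply_eq (F := ℚ) (x := ζ) (y := ζ ^ t)
    ((hζ.isIntegral hn).tower_top) (by
      rw [← Polynomial.cyclotomic_eq_minpoly_rat hζ hn, Polynomial.aeval_def,
        Polynomial.eval₂_eq_eval_map, Polynomial.map_cyclotomic]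
      exact hζt.isRoot_cyclotomic hn)
  have h2 := apply_apply_eq_of_mem_selmerField hK hD σ.toRingHom hmem
  change σ (σ ζ) = ζ at h2
  rw [hσ, map_pow, hσ, ← pow_mul] at h2
  have h3 : t * t ≡ 1 [MOD n] := by
    have hu : IsPrimitiveRoot (Units.mk0 ζ (hζ.ne_zero hn.ne')) n :=
      IsPrimitiveRoot.coe_units_iff.mp hζ
    rw [hu.eq_orderOf, ← pow_eq_pow_iff_modEq, pow_one]
    ext
    simpa using h2
  ext
  have h4 := (ZMod.natCast_eq_natCast_iff _ _ _).mpr h3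
  push_cast at h4
  rw [ZMod.natCast_zmod_val] at h4
  rw [Units.val_pow_eq_pow_val, pow_two, h4, Units.val_one]

end

/-! ### Roots of unity in the field of square roots -/

section

variable {K : Type*} [Field K] [NumberField K] [Algebra K ℂ] {D : ℕ}

theorem mem_selmerField_of_pow_four_eq_one {x : ℂ} (hx : x ^ 4 = 1) : x ∈ selmerField K := by
  have h : (x ^ 2 - 1) * (x ^ 2 + 1) = 0 := by linear_combination hx
  rcases mul_eq_zero.mp h with h | h
  · exact mem_selmerField ⟨1, 1, by simp, by simpa using sub_eq_zero.mp h⟩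
  · refine mem_selmerField ⟨-1, 1, by rw [one_pow, toPrincipalIdeal_neg_one], ?_⟩
    simpa using eq_neg_of_add_eq_zero_left h

/-- If `p` ramifies in `K`, then `√p` and `√-p` lie in `selmerField K`. -/
theorem mem_selmerField_of_sq_eq_prime (hK : Module.finrank ℚ K = 2) (hD : discr K = -(D : ℤ))
    {p : ℕ} (hp : p.Prime) (hpD : p ∣ D) {x : ℂ} (hx : x ^ 2 = p ∨ x ^ 2 = -p) :
    x ∈ selmerField K := by
  have hp0 : (p : K) ≠ 0 := by exact_mod_cast hp.ne_zero
  obtain ⟨J, hJ⟩ := (dvd_discr_iff_exists_sq_eq hK hp (Units.val_mk0 hp0)).mp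
    (by rw [hD, dvd_neg]; exact_mod_cast hpD)
  rcases hx with hx | hx
  · exact mem_selmerField ⟨_, J, hJ, by simpa using hx⟩
  · refine mem_selmerField ⟨-1 * Units.mk0 _ hp0, J, ?_, by simpa using hx⟩
    rw [map_mul, toPrincipalIdeal_neg_one, one_mul, hJ]

theorem dvd_of_sq_eq_prime_of_mem_selmerField (hK : Module.finrank ℚ K = 2)
    (hD : discr K = -(D : ℤ)) (hD4 : 4 < D) {p : ℕ} (hp : p.Prime) {x : ℂ}
    (hx : x ^ 2 = p ∨ x ^ 2 = -p) (hmem : x ∈ selmerField K) : p ∣ D := by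
  have hp0 : (p : K) ≠ 0 := by exact_mod_cast hp.ne_zero
  have h : ∃ J : (FractionalIdeal (𝓞 K)⁰ K)ˣ,
      J ^ 2 = toPrincipalIdeal (𝓞 K) K (Units.mk0 _ hp0) := by
    rcases hx with hx | hx
    · exact exists_sq_eq_of_mem_selmerField hK hD hD4 hmem (by simpa using hx)
    · obtain ⟨J, hJ⟩ := exists_sq_eq_of_mem_selmerField hK hD hD4 hmem
        (α := -1 * Units.mk0 _ hp0) (by simpa using hx)
      exact ⟨J, by rw [hJ, map_mul, toPrincipalIdeal_neg_one, one_mul]⟩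
  have := (dvd_discr_iff_exists_sq_eq hK hp (Units.val_mk0 hp0)).mpr h
  rw [hD, dvd_neg] at this
  exact_mod_cast this

theorem mem_selmerField_of_pow_three_eq_one (hK : Module.finrank ℚ K = 2)
    (hD : discr K = -(D : ℤ)) (h3 : 3 ∣ D) {x : ℂ} (hx : x ^ 3 = 1) : x ∈ selmerField K := by
  have h : (x - 1) * (x ^ 2 + x + 1) = 0 := by linear_combination hx
  rcases mul_eq_zero.mp h with h | h
  · rw [sub_eq_zero.mp h]
    exact one_mem _
  · have hmem : 2 * x + 1 ∈ selmerField K :=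
      mem_selmerField_of_sq_eq_prime hK hD Nat.prime_three h3
        (Or.inr (by push_cast; linear_combination 4 * h))
    rw [show x = (2 * x + 1 - 1) / 2 by ring]
    exact div_mem (sub_mem hmem (one_mem _)) (by exact_mod_cast natCast_mem (selmerField K) 2)

theorem mem_selmerField_of_pow_eight_eq_one (hK : Module.finrank ℚ K = 2)
    (hD : discr K = -(D : ℤ)) (h2 : 2 ∣ D) {x : ℂ} (hx : x ^ 8 = 1) : x ∈ selmerField K := by
  have h : (x ^ 4 - 1) * (x ^ 4 + 1) = 0 := by linear_combination hx
  rcases mul_eq_zero.mp h with h | h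
  · exact mem_selmerField_of_pow_four_eq_one (sub_eq_zero.mp h)
  · have hx0 : x ≠ 0 := by
      rintro rfl
      norm_num at hx
    -- For a primitive eighth root of unity, `x + x⁻¹ = x⁻¹ * (1 + x ^ 2)` is a square root of `2`.
    have hmem : x⁻¹ * (1 + x ^ 2) ∈ selmerField K := by
      refine mem_selmerField_of_sq_eq_prime hK hD Nat.prime_two h2 (Or.inl ?_)
      field_simp
      push_cast
      linear_combination h
    have h4 : x ^ 2 ∈ selmerField K :=
      mem_selmerField_of_pow_four_eq_one (by rw [← pow_mul, ← hx])
    have hne : 1 + x ^ 2 ≠ 0 := by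
      intro h0
      have : (2 : ℂ) = 0 := by linear_combination h - (x ^ 2 - 1) * h0
      norm_num at this
    have hinv : x⁻¹ ∈ selmerField K := by
      rw [show x⁻¹ = x⁻¹ * (1 + x ^ 2) / (1 + x ^ 2) by field_simp]
      exact div_mem hmem (add_mem (one_mem _) h4)
    rw [← inv_inv x]
    exact inv_mem hinv

theorem mem_selmerField_of_pow_rootOrder_eq_one (hK : Module.finrank ℚ K = 2)
    (hD : discr K = -(D : ℤ)) {x : ℂ} (hx : x ^ (2 * rootOrder D) = 1) : x ∈ selmerField K := by
  have hx0 : x ≠ 0 := by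
    rintro rfl
    rw [zero_pow] at hx
    · norm_num at hx
    · unfold rootOrder
      split_ifs <;> norm_num
  have hsplit : x = x ^ 9 / x ^ 8 := by field_simp
  unfold rootOrder at hx
  split_ifs at hx with h6 h3 h2
  · exact mem_selmerField_of_pow_four_eq_one hx
  · rw [hsplit]
    refine div_mem (mem_selmerField_of_pow_eight_eq_one hK hD h2 ?_)
      (mem_selmerField_of_pow_three_eq_one hK hD h3 ?_)
    · rw [← pow_mul, show 9 * 8 = 2 * 12 * 3 from rfl, pow_mul, hx, one_pow]
    · rw [← pow_mul, show 8 * 3 = 2 * 12 * 1 from rfl, pow_mul, hx, one_pow]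
  · rw [hsplit]
    refine div_mem (mem_selmerField_of_pow_four_eq_one ?_)
      (mem_selmerField_of_pow_three_eq_one hK hD h3 ?_)
    · rw [← pow_mul, show 9 * 4 = 2 * 6 * 3 from rfl, pow_mul, hx, one_pow]
    · rw [← pow_mul, show 8 * 3 = 2 * 6 * 2 from rfl, pow_mul, hx, one_pow]
  · have h2 : 2 ∣ D := by
      by_contra h2
      exact h6 (Nat.Coprime.mul_left (m := 2) (n := 3)
        ((Nat.Prime.coprime_iff_not_dvd Nat.prime_two).mpr h2)
        ((Nat.Prime.coprime_iff_not_dvd Nat.prime_three).mpr h3))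
    exact mem_selmerField_of_pow_eight_eq_one hK hD h2 hx

theorem dvd_rootOrder_of_mem_selmerField (hK : Module.finrank ℚ K = 2)
    (hD : discr K = -(D : ℤ)) (hD4 : 4 < D) {s : ℂ} {e : ℕ} (he0 : 0 < e)
    (hs : IsPrimitiveRoot s (2 * e)) (hmem : s ∈ selmerField K) : e ∣ rootOrder D := by
  have h24 : 2 * e ∣ 2 * 12 := dvd_twentyFour_of_mem_selmerField hK hD (by positivity) hs hmem
  have h12 : e ∣ 12 := (Nat.mul_dvd_mul_iff_left two_pos).mp h24
  have h3 (h : 3 ∣ e) : 3 ∣ D := by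
    obtain ⟨k, hk⟩ := h
    have hω : IsPrimitiveRoot (s ^ (2 * k)) 3 := hs.pow (by positivity) (by rw [hk]; ring)
    have hω1 : s ^ (2 * k) - 1 ≠ 0 := sub_ne_zero.mpr (hω.ne_one (by norm_num))
    set ω := s ^ (2 * k)
    have hq : ω ^ 2 + ω + 1 = 0 := by
      apply mul_left_cancel₀ hω1
      linear_combination hω.pow_eq_one
    refine dvd_of_sq_eq_prime_of_mem_selmerField hK hD hD4 Nat.prime_three (x := 2 * ω + 1)
      (Or.inr (by push_cast; linear_combination 4 * hq)) ?_
    exact add_mem (mul_mem (by exact_mod_cast natCast_mem (selmerField K) 2)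
      (pow_mem hmem _)) (one_mem _)
  have h2 (h : 4 ∣ e) : 2 ∣ D := by
    obtain ⟨k, hk⟩ := h
    have hη : IsPrimitiveRoot (s ^ k) 8 := hs.pow (by positivity) (by rw [hk]; ring)
    have hη4 : (s ^ k) ^ 4 ≠ 1 := hη.pow_ne_one_of_pos_of_lt (by norm_num) (by norm_num)
    have hη0 : s ^ k ≠ 0 := hη.ne_zero (by norm_num)
    have hηm : s ^ k ∈ selmerField K := pow_mem hmem _
    have hη8 := hη.pow_eq_one
    set η := s ^ k
    have hq : η ^ 4 + 1 = 0 := by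
      apply mul_left_cancel₀ (sub_ne_zero.mpr hη4)
      linear_combination hη8
    refine dvd_of_sq_eq_prime_of_mem_selmerField hK hD hD4 Nat.prime_two
      (x := η⁻¹ * (1 + η ^ 2)) (Or.inl ?_) ?_
    · field_simp
      push_cast
      linear_combination hq
    · exact mul_mem (inv_mem hηm) (add_mem (one_mem _) (pow_mem hηm 2))
  have h6 (h : Nat.Coprime 6 D) : ¬ 2 ∣ D ∧ ¬ 3 ∣ D := by
    rw [show 6 = 2 * 3 from rfl, Nat.coprime_mul_iff_left,
      Nat.Prime.coprime_iff_not_dvd Nat.prime_two,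
      Nat.Prime.coprime_iff_not_dvd Nat.prime_three] at h
    exact h
  have hle : e ≤ 12 := Nat.le_of_dvd (by norm_num) h12
  unfold rootOrder
  split_ifs with h6' h3' h2'
  · have := mt h2 (h6 h6').1
    have := mt h3 (h6 h6').2
    interval_cases e <;> revert h12 <;> simp_all
  · exact h12
  · have := mt h2 h2'
    interval_cases e <;> revert h12 <;> simp_all
  · have := mt h3 h3'
    interval_cases e <;> revert h12 <;> simp_all

end

/-! ### The degree of `K(χ)` over `T_g` -/

section

variable {K : Type*} [Field K] [NumberField K] [Algebra K ℂ] {D : ℕ}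

omit [NumberField K] in
theorem exists_apply_eq_pow (σ : ℂ →ₐ[K] ℂ) {n : ℕ} (hn : 0 < n) {ω : ℂ}
    (hω : IsPrimitiveRoot ω n) : ∃ t : ℕ, ∀ ζ : ℂ, ζ ^ n = 1 → σ ζ = ζ ^ t := by
  have := NeZero.of_pos hn
  obtain ⟨t, -, ht⟩ := hω.eq_pow_of_pow_eq_one (ξ := σ ω) (by
    rw [← map_pow, hω.pow_eq_one, map_one])
  refine ⟨t, fun ζ hζ => ?_⟩
  obtain ⟨j, -, rfl⟩ := hω.eq_pow_of_pow_eq_one hζ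
  rw [map_pow, ← ht, ← pow_mul, ← pow_mul, mul_comm]

omit [NumberField K] in
theorem comm_apply_of_pow_eq_one (σ τ : ℂ →ₐ[K] ℂ) {n : ℕ} (hn : 0 < n) {ζ : ℂ}
    (hζ : ζ ^ n = 1) : σ (τ ζ) = τ (σ ζ) := by
  have hω := Complex.isPrimitiveRoot_exp n hn.ne'
  obtain ⟨s, hs⟩ := exists_apply_eq_pow σ hn hω
  obtain ⟨t, ht⟩ := exists_apply_eq_pow τ hn hω
  rw [ht ζ hζ, hs ζ hζ, map_pow, map_pow, hs ζ hζ, ht ζ hζ, ← pow_mul, ← pow_mul, mul_comm]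

omit [NumberField K] in
/-- The square roots of an element of `K` times a root of unity generate abelian extensions of
`K`. -/
theorem comm_apply_of_sq_eq_mul (σ τ : ℂ →ₐ[K] ℂ) {n : ℕ} (hn : 0 < n) {y ζ : ℂ} {α : K}
    (hζ : ζ ^ n = 1) (hy : y ^ 2 = ζ * algebraMap K ℂ α) : σ (τ y) = τ (σ y) := by
  obtain ⟨w, hw⟩ := IsAlgClosed.exists_pow_nat_eq ζ two_pos
  have hζ0 : ζ ≠ 0 := by
    rintro rfl
    rw [zero_pow hn.ne'] at hζ
    exact zero_ne_one hζ
  have hw0 : w ≠ 0 := by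
    rintro rfl
    exact hζ0 (by rw [← hw]; norm_num)
  have hwn : w ^ (2 * n) = 1 := by rw [pow_mul, hw, hζ]
  have hz : (y / w) ^ 2 = algebraMap K ℂ α := by
    rw [div_pow, hy, hw, mul_div_cancel_left₀ _ hζ0]
  have hsign (ρ : ℂ →ₐ[K] ℂ) : ρ (y / w) = y / w ∨ ρ (y / w) = -(y / w) := by
    apply sq_eq_sq_iff_eq_or_eq_neg.mp
    rw [← map_pow, hz, AlgHom.commutes]
  have hcomm : σ (τ (y / w)) = τ (σ (y / w)) := by
    rcases hsign σ with h | h <;> rcases hsign τ with h' | h' <;>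
      simp only [h, h', map_neg]
  rw [← div_mul_cancel₀ y hw0, map_mul, map_mul, map_mul, map_mul, hcomm,
    comm_apply_of_pow_eq_one σ τ (by positivity) hwn]

variable {f : Ideal (𝓞 K)} {ε : (𝓞 K ⧸ f)ˣ →* ℂˣ} {Φ : (K →+* ℂ) → ℤ}
  {χ : AlgebraicHeckeCharacter K f Φ}

omit [Algebra K ℂ] in
theorem exists_pow_eq_one_of_residue (hf : f ≠ ⊥) :
    ∃ n, 0 < n ∧ ∀ u : (𝓞 K ⧸ f)ˣ, (ε u : ℂ) ^ n = 1 := by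
  have : Finite (𝓞 K ⧸ f) := Ideal.finiteQuotientOfFreeOfNeBot f hf
  refine ⟨Nat.card (𝓞 K ⧸ f)ˣ, Nat.card_pos, fun u => ?_⟩
  rw [← Units.val_pow_eq_pow_val, ← map_pow, pow_card_eq_one', map_one, Units.val_one]

theorem exists_apply_eq_mul (hf : f ≠ ⊥) (hχ : HasFiniteType χ ε) {I : idealsPrimeTo f} {α : Kˣ}
    (hI : (I : (FractionalIdeal (𝓞 K)⁰ K)ˣ) = toPrincipalIdeal (𝓞 K) K α) :
    ∃ u, (χ.toHom I : ℂ) = (ε u : ℂ) * algebraMap K ℂ α := by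
  obtain ⟨u, hu⟩ := exists_hasResidue hf hI
  exact ⟨u, hχ α u I hI hu⟩

variable (f) in
/-- The class of an ideal prime to `f`. -/
def idealClass : idealsPrimeTo f →* ClassGroup (𝓞 K) :=
  (ClassGroup.mk K).comp (idealsPrimeTo f).subtype

omit [Algebra K ℂ] in
theorem idealClass_eq_one_iff {I : idealsPrimeTo f} : idealClass f I = 1 ↔
    ∃ α : Kˣ, (I : (FractionalIdeal (𝓞 K)⁰ K)ˣ) = toPrincipalIdeal (𝓞 K) K α :=
  classGroup_mk_eq_one_iff

omit [Algebra K ℂ] in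
theorem idealClass_surjective (hf : f ≠ ⊥) : Function.Surjective (idealClass f) := by
  intro c
  obtain ⟨J, rfl⟩ := classGroup_mk_surjective K c
  obtain ⟨β, hβ⟩ := exists_mul_mem_idealsPrimeTo hf J
  refine ⟨⟨_, hβ⟩, ?_⟩
  change ClassGroup.mk K (J * toPrincipalIdeal (𝓞 K) K β) = _
  rw [map_mul, classGroup_mk_eq_one_iff.mpr ⟨β, rfl⟩, mul_one]

/-- Some power of `I` is principal, and the value of `χ` there is known. -/
theorem exists_pow_apply_eq (hf : f ≠ ⊥) (hχ : HasFiniteType χ ε) {I : idealsPrimeTo f} {n : ℕ}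
    (h : idealClass f I ^ n = 1) : ∃ (α : Kˣ) (u : (𝓞 K ⧸ f)ˣ),
      (I : (FractionalIdeal (𝓞 K)⁰ K)ˣ) ^ n = toPrincipalIdeal (𝓞 K) K α ∧
      (χ.toHom I : ℂ) ^ n = (ε u : ℂ) * algebraMap K ℂ α := by
  rw [← map_pow] at h
  obtain ⟨α, hα⟩ := idealClass_eq_one_iff.mp h
  obtain ⟨u, hu⟩ := exists_apply_eq_mul hf hχ hα
  rw [map_pow, Units.val_pow_eq_pow_val] at hu
  exact ⟨α, u, hα, hu⟩

/-- An ideal on which the value of `χ` is an element `k` of `K` up to a root of unity is principal,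
generated by `k`: a power of it is generated by the corresponding power of `k`. -/
theorem idealClass_eq_one_of_apply_eq (hf : f ≠ ⊥) (hχ : HasFiniteType χ ε)
    {I : idealsPrimeTo f} {k : K} {ζ : ℂ} {n : ℕ} (hn : 0 < n) (hζ : ζ ^ n = 1)
    (h : (χ.toHom I : ℂ) = algebraMap K ℂ k * ζ) :
    idealClass f I = 1 := by
  have hk0 : k ≠ 0 := by
    rintro rfl
    rw [map_zero, zero_mul] at h
    exact Units.ne_zero _ h
  have hN : 0 < Nat.card (ClassGroup (𝓞 K)) := Nat.card_pos
  obtain ⟨α, u, hα, hu⟩ := exists_pow_apply_eq hf hχ (pow_card_eq_one' (x := idealClass f I))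
  set N := Nat.card (ClassGroup (𝓞 K))
  obtain ⟨e, he, hεe⟩ := exists_pow_eq_one_of_residue (ε := ε) hf
  have hpow : (α * ((Units.mk0 k hk0) ^ N)⁻¹ : Kˣ) ^ (e * n) = 1 := by
    have h1 : algebraMap K ℂ α ^ (e * n) = (algebraMap K ℂ k ^ N) ^ (e * n) := by
      calc algebraMap K ℂ α ^ (e * n)
          = ((ε u : ℂ) ^ e) ^ n * algebraMap K ℂ α ^ (e * n) := by rw [hεe, one_pow, one_mul]
        _ = ((ε u : ℂ) * algebraMap K ℂ α) ^ (e * n) := by rw [← pow_mul, mul_pow]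
        _ = (algebraMap K ℂ k ^ N) ^ (e * n) * (ζ ^ n) ^ (N * e) := by rw [← hu, h]; ring
        _ = (algebraMap K ℂ k ^ N) ^ (e * n) := by rw [hζ, one_pow, mul_one]
    rw [← map_pow, ← map_pow, ← map_pow] at h1
    ext
    have h2 := (algebraMap K ℂ).injective h1
    rw [Units.val_pow_eq_pow_val, Units.val_mul, Units.val_inv_eq_inv_val,
      Units.val_pow_eq_pow_val, Units.val_mk0, mul_pow, h2, inv_pow,
      mul_inv_cancel₀ (pow_ne_zero _ (pow_ne_zero _ hk0)), Units.val_one]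
  have hIk : (I : (FractionalIdeal (𝓞 K)⁰ K)ˣ) ^ N =
      (toPrincipalIdeal (𝓞 K) K (Units.mk0 k hk0)) ^ N := by
    rw [hα, ← map_pow, ← div_eq_one, ← map_div, div_eq_mul_inv]
    exact fractionalIdeal_eq_one_of_pow_eq_one (Nat.mul_pos he hn)
      (by rw [← map_pow, hpow, map_one])
  exact idealClass_eq_one_iff.mpr ⟨_, fractionalIdeal_pow_left_injective hN hIk⟩

/-- The field generated by `T_g` and all roots of unity, an abelian extension of `K`. -/
def genusCyclotomicField (χ : AlgebraicHeckeCharacter K f Φ) : IntermediateField K ℂ :=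
  genusField χ ⊔ IntermediateField.adjoin K {ζ : ℂ | ∃ n : ℕ, 0 < n ∧ ζ ^ n = 1}

theorem genusField_le_genusCyclotomicField (χ : AlgebraicHeckeCharacter K f Φ) :
    genusField χ ≤ genusCyclotomicField χ :=
  le_sup_left

theorem mem_genusCyclotomicField {ζ : ℂ} {n : ℕ} (hn : 0 < n) (hζ : ζ ^ n = 1) :
    ζ ∈ genusCyclotomicField χ :=
  (le_sup_right : _ ≤ genusCyclotomicField χ) (IntermediateField.subset_adjoin K _ ⟨n, hn, hζ⟩)

theorem comm_apply_of_mem_genusCyclotomicField (hf : f ≠ ⊥) (hχ : HasFiniteType χ ε)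
    (σ τ : ℂ →ₐ[K] ℂ) {x : ℂ} (hx : x ∈ genusCyclotomicField χ) : σ (τ x) = τ (σ x) := by
  rw [genusCyclotomicField, genusField, ← IntermediateField.adjoin_union] at hx
  induction hx using IntermediateField.adjoin_induction with
  | mem y hy =>
    rcases hy with ⟨I, ⟨α, hα⟩, rfl⟩ | ⟨n, hn, hy⟩
    · obtain ⟨e, he, hεe⟩ := exists_pow_eq_one_of_residue (ε := ε) hf
      have h1 : idealClass f I ^ 2 = 1 := by
        rw [← map_pow]
        exact idealClass_eq_one_iff.mpr ⟨α, hα⟩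
      obtain ⟨β, u, -, hu⟩ := exists_pow_apply_eq hf hχ h1
      exact comm_apply_of_sq_eq_mul σ τ he (hεe u) hu
    · exact comm_apply_of_pow_eq_one σ τ hn hy
  | algebraMap x => simp
  | add x y _ _ hx hy => simp only [map_add, hx, hy]
  | inv x _ hx => simp only [map_inv₀, hx]
  | mul x y _ _ hx hy => simp only [map_mul, hx, hy]

theorem isIntegral_apply (hf : f ≠ ⊥) (hχ : HasFiniteType χ ε) (I : idealsPrimeTo f) :
    IsIntegral K (χ.toHom I : ℂ) := by
  obtain ⟨α, u, -, hu⟩ := exists_pow_apply_eq hf hχ (pow_card_eq_one' (x := idealClass f I))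
  obtain ⟨e, he, hεe⟩ := exists_pow_eq_one_of_residue (ε := ε) hf
  refine IsIntegral.of_pow (n := Nat.card (ClassGroup (𝓞 K))) Nat.card_pos ?_
  rw [hu]
  exact (IsIntegral.of_pow he (by rw [hεe]; exact isIntegral_one)).mul isIntegral_algebraMap

theorem exists_pow_apply_div_eq_one (hf : f ≠ ⊥) (hχ : HasFiniteType χ ε) (I : idealsPrimeTo f) :
    ∃ e, 0 < e ∧ ∀ σ : ℂ →ₐ[K] ℂ,
      (σ (χ.toHom I) / χ.toHom I) ^ (orderOf (idealClass f I) * e) = 1 := by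
  obtain ⟨α, u, -, hu⟩ := exists_pow_apply_eq hf hχ (pow_orderOf_eq_one (idealClass f I))
  obtain ⟨e, he, hεe⟩ := exists_pow_eq_one_of_residue (ε := ε) hf
  refine ⟨e, he, fun σ => ?_⟩
  rw [div_pow, ← map_pow, pow_mul, hu, mul_pow, hεe, one_mul, ← map_pow, AlgHom.commutes,
    div_self]
  simp

/-- If the value of `χ` at `I` lies in an abelian extension of `K`, then `I ^ 2` is principal.

Let `N` be the order of the class of `I`, let `g = χ I`, and let `τ` act on roots of unity by
`ζ ↦ ζ ^ t`. As all `σ` commute with `τ` on `g`, they fix `g ^ t / τ g`, so that `I ^ t / I` is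
principal, and `t ≡ 1 mod N`. Therefore the `N`-th roots of unity lie in `K`. -/
theorem idealClass_sq_eq_one_of_mem (hK : Module.finrank ℚ K = 2) (hD : discr K = -(D : ℤ))
    (hD4 : 4 < D) (hf : f ≠ ⊥) (hχ : HasFiniteType χ ε) {I : idealsPrimeTo f}
    (hI : (χ.toHom I : ℂ) ∈ genusCyclotomicField χ) : idealClass f I ^ 2 = 1 := by
  obtain ⟨e, he, hroot⟩ := exists_pow_apply_div_eq_one hf hχ I
  have hN : 0 < orderOf (idealClass f I) := orderOf_pos _
  set N := orderOf (idealClass f I) with hNdef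
  have hm : 0 < N * e := Nat.mul_pos hN he
  have hω := Complex.isPrimitiveRoot_exp (N * e) hm.ne'
  set ω := Complex.exp (2 * Real.pi * Complex.I / (N * e : ℕ))
  have hωe : IsPrimitiveRoot (ω ^ e) N := hω.pow hm (mul_comm _ _)
  have hg0 : (χ.toHom I : ℂ) ≠ 0 := Units.ne_zero _
  have hfix (τ : ℂ →ₐ[K] ℂ) : τ (ω ^ e) = ω ^ e := by
    obtain ⟨t, ht⟩ := exists_apply_eq_pow τ hm hω
    have hτg0 : τ (χ.toHom I : ℂ) ≠ 0 := by simp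
    obtain ⟨k, hk⟩ : (χ.toHom I : ℂ) ^ t / τ (χ.toHom I) ∈ (algebraMap K ℂ).range := by
      have hi := isIntegral_apply hf hχ I
      refine mem_range_of_forall_algHom_apply_eq ?_ fun σ => ?_
      · rw [div_eq_mul_inv]
        exact (hi.pow t).mul (hi.map τ).inv
      · have h1 : σ (τ (χ.toHom I)) = (σ (χ.toHom I) / χ.toHom I) ^ t * τ (χ.toHom I) := by
          rw [← ht _ (hroot σ), map_div₀, div_mul_cancel₀ _ hτg0,
            comm_apply_of_mem_genusCyclotomicField hf hχ σ τ hI]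
        have h2 : σ (χ.toHom I : ℂ) ≠ 0 := by simp
        rw [map_div₀, map_pow, h1]
        field_simp
        rw [div_pow, div_mul_cancel₀ _ (pow_ne_zero _ hg0)]
    have h1 : idealClass f (I ^ t / I) = 1 := by
      refine idealClass_eq_one_of_apply_eq hf hχ (k := k) hm (hroot τ) ?_
      rw [hk, map_div, map_pow, Units.val_div_eq_div_val, Units.val_pow_eq_pow_val]
      field_simp
    rw [map_div, map_pow, div_eq_one] at h1
    have h2 : t ≡ 1 [MOD N] := pow_eq_pow_iff_modEq.mp (h1.trans (pow_one _).symm)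
    rw [ht _ (by rw [← pow_mul, mul_comm, pow_mul, hω.pow_eq_one, one_pow])]
    have hu : IsPrimitiveRoot (Units.mk0 (ω ^ e) (hωe.ne_zero hN.ne')) N :=
      IsPrimitiveRoot.coe_units_iff.mp hωe
    rw [hu.eq_orderOf, ← pow_eq_pow_iff_modEq, pow_one] at h2
    simpa using congrArg Units.val h2
  obtain ⟨k, hk⟩ := mem_range_of_forall_algHom_apply_eq
    (IsIntegral.of_pow hN (by rw [hωe.pow_eq_one]; exact isIntegral_one)) hfix
  have hkN : k ^ N = 1 := by
    apply (algebraMap K ℂ).injective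
    rw [map_pow, hk, hωe.pow_eq_one, map_one]
  have hk2 : k ^ 2 = 1 := by
    rcases eq_one_or_neg_one_of_pow_eq_one hK hD hD4 hN hkN with rfl | rfl <;> norm_num
  have hN2 : N ∣ 2 := hωe.dvd_of_pow_eq_one 2 (by rw [← hk, ← map_pow, hk2, map_one])
  exact orderOf_dvd_iff_pow_eq_one.mp hN2

theorem mem_genusField_of_sq_eq_one {I : idealsPrimeTo f} (h : idealClass f I ^ 2 = 1) :
    (χ.toHom I : ℂ) ∈ genusField χ := by
  rw [← map_pow] at h
  obtain ⟨α, hα⟩ := idealClass_eq_one_iff.mp h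
  exact IntermediateField.subset_adjoin K _ ⟨I, ⟨α, hα⟩, rfl⟩

theorem genusField_le_valueField : genusField χ ≤ valueField χ := by
  apply IntermediateField.adjoin.mono
  rintro z ⟨I, -, rfl⟩
  exact ⟨I, rfl⟩

variable (f) in
/-- The ideals prime to `f` whose square is principal. -/
def genusIdeals : Subgroup (idealsPrimeTo f) :=
  (twoTorsionClasses K).comap (idealClass f)

omit [Algebra K ℂ] in
theorem mem_genusIdeals {I : idealsPrimeTo f} : I ∈ genusIdeals f ↔ idealClass f I ^ 2 = 1 :=
  Iff.rfl

omit [Algebra K ℂ] in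
theorem index_genusIdeals_mul (hf : f ≠ ⊥) :
    (genusIdeals f).index * Nat.card (twoTorsionClasses K) = classNumber K := by
  rw [genusIdeals, Subgroup.index_comap_of_surjective _ (idealClass_surjective hf),
    Subgroup.index_mul_card, classNumber, Nat.card_eq_fintype_card]

theorem linearIndependent_apply_out_genusCyclotomicField (hK : Module.finrank ℚ K = 2)
    (hD : discr K = -(D : ℤ)) (hD4 : 4 < D) (hf : f ≠ ⊥) (hχ : HasFiniteType χ ε) :
    LinearIndependent (genusCyclotomicField χ)
      (fun q : idealsPrimeTo f ⧸ genusIdeals f => (χ.toHom q.out : ℂ)) := by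
  have hint (I : idealsPrimeTo f) : IsIntegral (genusCyclotomicField χ) (χ.toHom I : ℂ) :=
    (isIntegral_apply hf hχ I).tower_top
  have hroot (I : idealsPrimeTo f) (σ : ℂ →ₐ[genusCyclotomicField χ] ℂ) :
      σ (χ.toHom I) / χ.toHom I ∈ (algebraMap (genusCyclotomicField χ) ℂ).range := by
    obtain ⟨e, he, hroot⟩ := exists_pow_apply_div_eq_one hf hχ I
    exact ⟨⟨_, mem_genusCyclotomicField (Nat.mul_pos (orderOf_pos _) he)
      (hroot (σ.restrictScalars K))⟩, rfl⟩
  refine linearIndependent_of_div_notMem_range χ.toHom hint hroot _ ?_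
  rintro q q' hne ⟨x, hxq⟩
  apply hne
  rw [← q.out_eq', ← q'.out_eq', ← div_eq_one]
  refine (QuotientGroup.eq_one_iff (q.out / q'.out)).mpr (mem_genusIdeals.mpr ?_)
  refine idealClass_sq_eq_one_of_mem hK hD hD4 hf hχ ?_
  rw [← hxq]
  exact x.2

/-- `[T : T_g]` is the index of `Cl[2]` in the class group. -/
theorem finrank_valueField_mul (hK : Module.finrank ℚ K = 2) (hD : discr K = -(D : ℤ))
    (hD4 : 4 < D) (hf : f ≠ ⊥) (hχ : HasFiniteType χ ε) :
    Module.finrank K (valueField χ) * Nat.card (twoTorsionClasses K) =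
      Module.finrank K (genusField χ) * classNumber K := by
  have hindex := index_genusIdeals_mul hf
  have hfi : (genusIdeals f).FiniteIndex := ⟨fun h0 => by
    rw [h0, zero_mul] at hindex
    exact (classNumber_ne_zero K) hindex.symm⟩
  have hfin : Finite (idealsPrimeTo f ⧸ genusIdeals f) := inferInstance
  let Y : Submonoid ℂ := MonoidHom.mrange ((Units.coeHom ℂ).comp χ.toHom)
  have hT : valueField χ = IntermediateField.adjoin K (Y : Set ℂ) := by
    rw [valueField]
    congr 1
    ext z
    exact ⟨fun ⟨I, h⟩ => ⟨I, h.symm⟩, fun ⟨I, h⟩ => ⟨I, h.symm⟩⟩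
  have hcover : ∀ y ∈ Y, ∃ q : idealsPrimeTo f ⧸ genusIdeals f, ∃ c ∈ genusField χ,
      y = c * (χ.toHom q.out : ℂ) := by
    rintro _ ⟨I, rfl⟩
    obtain ⟨J, hJ⟩ := QuotientGroup.mk_out_eq_mul (genusIdeals f) I
    have hJ' : (χ.toHom (J : idealsPrimeTo f)⁻¹ : ℂ) ∈ genusField χ :=
      mem_genusField_of_sq_eq_one (mem_genusIdeals.mp (inv_mem J.2))
    have hmul : (χ.toHom I : ℂ) = (χ.toHom (J : idealsPrimeTo f)⁻¹ : ℂ) *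
        χ.toHom (QuotientGroup.mk I : idealsPrimeTo f ⧸ genusIdeals f).out := by
      rw [← Units.val_mul, ← map_mul, hJ, mul_comm I, inv_mul_cancel_left]
    exact ⟨QuotientGroup.mk I, _, hJ', hmul⟩
  have hle : genusField χ ≤ IntermediateField.adjoin K (Y : Set ℂ) := by
    rw [← hT]
    exact genusField_le_valueField
  have hli : LinearIndependent (genusField χ)
      (fun q : idealsPrimeTo f ⧸ genusIdeals f => (χ.toHom q.out : ℂ)) :=
    linearIndependent_of_le (genusField_le_genusCyclotomicField χ)
      (linearIndependent_apply_out_genusCyclotomicField hK hD hD4 hf hχ)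
  have hmem (q : idealsPrimeTo f ⧸ genusIdeals f) : (χ.toHom q.out : ℂ) ∈ Y := ⟨q.out, rfl⟩
  have hdeg := finrank_adjoin_eq_mul_card Y hle _ hmem hcover hli
  rw [hT, hdeg, ← hindex, mul_assoc, Subgroup.index]

end

/-! ### Adjoining a square root of a generator of the image of `ε` -/

section

theorem finrank_sup_adjoin_sqrt {F C : Type*} [Field F] [Field C] [Algebra F C]
    (E : IntermediateField F C) {s : C} (hs : s ^ 2 ∈ E) (hsE : s ∉ E) :
    Module.finrank F ↥(E ⊔ IntermediateField.adjoin F {s}) = Module.finrank F E * 2 := by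
  let p : Polynomial E := Polynomial.X ^ 2 - Polynomial.C ⟨s ^ 2, hs⟩
  have hp : p.Monic := Polynomial.monic_X_pow_sub_C _ two_ne_zero
  have hps : Polynomial.aeval s p = 0 := by
    simp only [p, map_sub, map_pow, Polynomial.aeval_X, Polynomial.aeval_C]
    exact sub_self _
  have hint : IsIntegral E s := ⟨p, hp, hps⟩
  have hdeg : (minpoly E s).natDegree = 2 := by
    apply le_antisymm
    · refine (Polynomial.natDegree_le_natDegree (minpoly.min E s hp hps)).trans ?_
      exact (Polynomial.natDegree_X_pow_sub_C).le
    · rw [minpoly.two_le_natDegree_iff hint]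
      rintro ⟨x, rfl⟩
      exact hsE x.2
  rw [← hdeg, ← IntermediateField.adjoin.finrank hint, Module.finrank_mul_finrank,
    ← IntermediateField.restrictScalars_adjoin_eq_sup]
  rfl

variable {K : Type*} [Field K] [NumberField K] [Algebra K ℂ] {D : ℕ}
variable {f : Ideal (𝓞 K)} {ε : (𝓞 K ⧸ f)ˣ →* ℂˣ} {Φ : (K →+* ℂ) → ℤ}
  {χ : AlgebraicHeckeCharacter K f Φ}

omit [Algebra K ℂ] in
theorem exists_zpowers_eq_range (hf : f ≠ ⊥) : ∃ ζ : ℂˣ, Subgroup.zpowers ζ = ε.range := by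
  have : Finite (𝓞 K ⧸ f) := Ideal.finiteQuotientOfFreeOfNeBot f hf
  have : Finite ε.range := Set.finite_range ε
  obtain ⟨⟨ζ, hζ⟩, hgen⟩ := IsCyclic.exists_generator (α := ε.range)
  refine ⟨ζ, le_antisymm (Subgroup.zpowers_le.mpr hζ) fun x hx => ?_⟩
  obtain ⟨j, hj⟩ := hgen ⟨x, hx⟩
  exact ⟨j, congrArg Subtype.val hj⟩

omit [Algebra K ℂ] in
theorem isPrimitiveRoot_sqrt (hf : f ≠ ⊥) (hε : ε (-1) = -1) {ζ : ℂˣ}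
    (hζ : Subgroup.zpowers ζ = ε.range) {s : ℂ} (hs : s ^ 2 = ζ) :
    0 < orderOf ζ ∧ IsPrimitiveRoot s (2 * orderOf ζ) := by
  obtain ⟨e, he, hεe⟩ := exists_pow_eq_one_of_residue (ε := ε) hf
  have hζmem : ζ ∈ ε.range := hζ ▸ Subgroup.mem_zpowers ζ
  have hpos : 0 < orderOf ζ := by
    obtain ⟨u, hu⟩ := hζmem
    refine orderOf_pos_iff.mpr (isOfFinOrder_iff_pow_eq_one.mpr ⟨e, he, ?_⟩)
    ext
    rw [Units.val_pow_eq_pow_val, ← hu, hεe, Units.val_one]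
  have heven : 2 ∣ orderOf ζ := by
    have h1 : (-1 : ℂˣ) ∈ Subgroup.zpowers ζ := hζ ▸ ⟨-1, hε⟩
    have h2 : orderOf (-1 : ℂˣ) = 2 := orderOf_eq_prime (by norm_num) (by
      intro h
      have := congrArg Units.val h
      norm_num at this)
    exact h2 ▸ orderOf_dvd_of_mem_zpowers h1
  refine ⟨hpos, ?_⟩
  have hs0 : s ≠ 0 := by
    rintro rfl
    exact ζ.ne_zero (by rw [← hs]; norm_num)
  have hsu : Units.mk0 s hs0 ^ 2 = ζ := Units.ext hs
  suffices h : orderOf (Units.mk0 s hs0) = 2 * orderOf ζ by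
    have := (IsPrimitiveRoot.orderOf (Units.mk0 s hs0))
    rw [h] at this
    exact IsPrimitiveRoot.coe_units_iff.mpr this
  set w := Units.mk0 s hs0
  have h1 : orderOf w ∣ 2 * orderOf ζ := orderOf_dvd_of_pow_eq_one (by
    rw [pow_mul, hsu, pow_orderOf_eq_one])
  have h2 : orderOf ζ ∣ orderOf w := orderOf_dvd_of_pow_eq_one (by
    rw [← hsu, ← pow_mul, mul_comm, pow_mul, pow_orderOf_eq_one, one_pow])
  obtain ⟨k, hk⟩ := h2
  have hk2 : k ∣ 2 := by
    rw [hk, mul_comm 2] at h1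
    exact Nat.dvd_of_mul_dvd_mul_left hpos h1
  rcases (Nat.dvd_prime Nat.prime_two).mp hk2 with rfl | rfl
  · exfalso
    obtain ⟨m, hm⟩ := heven
    have h3 : ζ ^ m = 1 := by rw [← hsu, ← pow_mul, ← hm, ← mul_one (orderOf ζ), ← hk,
      pow_orderOf_eq_one]
    have h4 : 0 < m := by lia
    have := Nat.le_of_dvd h4 (orderOf_dvd_of_pow_eq_one h3)
    lia
  · rw [hk, mul_comm]

omit [NumberField K] [Algebra K ℂ] in
/-- The values of `ε` are squares of powers of `s`. -/
theorem exists_zpow_sq_eq {ζ : ℂˣ} (hζ : Subgroup.zpowers ζ = ε.range) {s : ℂ}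
    (hs : s ^ 2 = ζ) (u : (𝓞 K ⧸ f)ˣ) : ∃ j : ℤ, (ε u : ℂ) = (s ^ j) ^ 2 := by
  have h : ε u ∈ Subgroup.zpowers ζ := hζ ▸ ⟨u, rfl⟩
  obtain ⟨j, hj⟩ := h
  refine ⟨j, ?_⟩
  rw [← hj, Units.val_zpow_eq_zpow_val, ← hs, ← zpow_natCast, ← zpow_natCast, ← zpow_mul,
    ← zpow_mul, mul_comm]

theorem selmerField_le_sup (hf : f ≠ ⊥) (hχ : HasFiniteType χ ε) {ζ : ℂˣ}
    (hζ : Subgroup.zpowers ζ = ε.range) {s : ℂ} (hs : s ^ 2 = ζ) :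
    selmerField K ≤ genusField χ ⊔ IntermediateField.adjoin K {s} := by
  rw [selmerField, IntermediateField.adjoin_le_iff]
  rintro y ⟨α, J, hJ, hy⟩
  obtain ⟨β, hβ⟩ := exists_mul_mem_idealsPrimeTo hf J
  set I : idealsPrimeTo f := ⟨_, hβ⟩
  have hI : ((I ^ 2 : idealsPrimeTo f) : (FractionalIdeal (𝓞 K)⁰ K)ˣ) =
      toPrincipalIdeal (𝓞 K) K (α * β ^ 2) := by
    rw [Subgroup.coe_pow, map_mul, map_pow, ← hJ, ← mul_pow]
  obtain ⟨u, hu⟩ := exists_apply_eq_mul hf hχ hI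
  obtain ⟨j, hj⟩ := exists_zpow_sq_eq hζ hs u
  have hs0 : s ≠ 0 := by
    rintro rfl
    exact ζ.ne_zero (by rw [← hs]; norm_num)
  have hβ0 : algebraMap K ℂ β ≠ 0 := by simp
  have hsq : y ^ 2 = ((χ.toHom I : ℂ) / (s ^ j * algebraMap K ℂ β)) ^ 2 := by
    have hsj : (s ^ j : ℂ) ≠ 0 := zpow_ne_zero _ hs0
    rw [map_pow, Units.val_pow_eq_pow_val, hj, Units.val_mul, map_mul, Units.val_pow_eq_pow_val,
      map_pow] at hu
    rw [div_pow, hu, hy]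
    field_simp
  have hmem : (χ.toHom I : ℂ) / (s ^ j * algebraMap K ℂ β) ∈
      genusField χ ⊔ IntermediateField.adjoin K {s} := by
    refine div_mem ((le_sup_left : genusField χ ≤ _) (mem_genusField_of_sq_eq_one ?_))
      (mul_mem (zpow_mem ((le_sup_right : IntermediateField.adjoin K {s} ≤ _)
        (IntermediateField.mem_adjoin_simple_self K s)) j) (IntermediateField.algebraMap_mem _ _))
    rw [← map_pow]
    exact idealClass_eq_one_iff.mpr ⟨_, hI⟩
  rcases sq_eq_sq_iff_eq_or_eq_neg.mp hsq with h | h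
  · rw [h]
    exact hmem
  · rw [h]
    exact neg_mem hmem

theorem sup_le_selmerField (hf : f ≠ ⊥) (hχ : HasFiniteType χ ε) {ζ : ℂˣ}
    (hζ : Subgroup.zpowers ζ = ε.range) {s : ℂ} (hs : s ^ 2 = ζ) (hmem : s ∈ selmerField K) :
    genusField χ ⊔ IntermediateField.adjoin K {s} ≤ selmerField K := by
  refine sup_le ?_ (by simpa using hmem)
  rw [genusField, IntermediateField.adjoin_le_iff]
  rintro _ ⟨I, ⟨α, hα⟩, rfl⟩
  obtain ⟨u, hu⟩ := exists_apply_eq_mul (I := I ^ 2) hf hχ hα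
  obtain ⟨j, hj⟩ := exists_zpow_sq_eq hζ hs u
  have hs0 : s ≠ 0 := by
    rintro rfl
    exact ζ.ne_zero (by rw [← hs]; norm_num)
  have hsj : (s ^ j : ℂ) ≠ 0 := zpow_ne_zero _ hs0
  have hroot : (χ.toHom I : ℂ) / s ^ j ∈ selmerField K := by
    refine mem_selmerField ⟨α, I, hα, ?_⟩
    rw [map_pow, Units.val_pow_eq_pow_val, hj] at hu
    rw [div_pow, hu]
    field_simp
  rw [← div_mul_cancel₀ (χ.toHom I : ℂ) hsj]
  exact mul_mem hroot (zpow_mem hmem j)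

/-- The values of `ε` lie in `T_g`, as principal ideals have principal squares. -/
theorem apply_mem_genusField (hχ : HasFiniteType χ ε) (u : (𝓞 K ⧸ f)ˣ) :
    (ε u : ℂ) ∈ genusField χ := by
  rcases subsingleton_or_nontrivial (𝓞 K ⧸ f) with h | h
  · rw [Subsingleton.elim u 1, map_one]
    exact one_mem _
  obtain ⟨a, ha⟩ := Ideal.Quotient.mk_surjective (u : 𝓞 K ⧸ f)
  have ha0 : a ≠ 0 := by
    rintro rfl
    exact u.ne_zero (by rw [← ha, map_zero])
  set α : Kˣ := Units.mk0 (a : K) (by simpa using ha0) with hαdef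
  have hprime : toPrincipalIdeal (𝓞 K) K α ∈ idealsPrimeTo f := by
    intro v hv
    have hva : a ∉ v.asIdeal := by
      intro hmem
      apply v.isPrime.ne_top
      obtain ⟨b, hb⟩ := Ideal.Quotient.mk_surjective ((u⁻¹ : (𝓞 K ⧸ f)ˣ) : 𝓞 K ⧸ f)
      have hab : a * b - 1 ∈ f := by
        rw [← Ideal.Quotient.eq_zero_iff_mem, map_sub, map_mul, ha, hb, Units.mul_inv, map_one,
          sub_self]
      rw [Ideal.eq_top_iff_one]
      have := sub_mem (v.asIdeal.mul_mem_right b hmem) (Ideal.dvd_iff_le.mp hv hab)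
      simpa using this
    have h1 := (HeightOneSpectrum.valuation_eq_one_iff_notMem (K := K) v).mpr hva
    have h2 := valuation_eq_exp_neg_count v α
    rw [hαdef, Units.val_mk0, h1, eq_comm, WithZero.exp_eq_one] at h2
    lia
  have hval := hχ α u ⟨_, hprime⟩ rfl ⟨a, 1, by simp, by simp [hαdef], by simp [ha]⟩
  have hα0 : algebraMap K ℂ α ≠ 0 := by simp
  rw [← mul_div_cancel_right₀ (ε u : ℂ) hα0, ← hval]
  refine div_mem (mem_genusField_of_sq_eq_one ?_) (IntermediateField.algebraMap_mem _ _)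
  rw [idealClass_eq_one_iff.mpr ⟨α, rfl⟩, one_pow]

/-- `T_g` depends only on `ε`: two characters with the same `ε` differ by a sign on the ideals with
principal square. -/
theorem genusField_le_genusField (hf : f ≠ ⊥) (hχ : HasFiniteType χ ε) {Φ' : (K →+* ℂ) → ℤ}
    {χ' : AlgebraicHeckeCharacter K f Φ'} (hχ' : HasFiniteType χ' ε) :
    genusField χ ≤ genusField χ' := by
  refine IntermediateField.adjoin_le_iff.mpr ?_
  rintro _ ⟨I, ⟨α, hα⟩, rfl⟩
  have hα' : ((I ^ 2 : idealsPrimeTo f) : (FractionalIdeal (𝓞 K)⁰ K)ˣ) =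
      toPrincipalIdeal (𝓞 K) K α := hα
  obtain ⟨u, hu⟩ := exists_hasResidue hf hα'
  have h1 := (hχ α u _ hα' hu).trans (hχ' α u _ hα' hu).symm
  rw [map_pow, map_pow, Units.val_pow_eq_pow_val, Units.val_pow_eq_pow_val] at h1
  have hmem : (χ'.toHom I : ℂ) ∈ genusField χ' :=
    IntermediateField.subset_adjoin K _ ⟨I, ⟨α, hα⟩, rfl⟩
  rcases sq_eq_sq_iff_eq_or_eq_neg.mp h1 with h | h
  · rw [h]
    exact hmem
  · rw [h]
    exact neg_mem hmem

omit [NumberField K] [Algebra K ℂ] in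
/-- A generator `ξ` of the `2`-primary part of the image of `ε` is a generator `ζ` of the image
up to a square, as it is not itself a square in the image. -/
theorem exists_eq_mul_sq (hε : ε (-1) = -1) {ζ ξ : ℂˣ} (hζ : Subgroup.zpowers ζ = ε.range)
    (hξ : Subgroup.zpowers ξ = muPrimary 2 ε) : ∃ u, ξ = ζ * ε u ^ 2 := by
  have hξmem : ξ ∈ muPrimary 2 ε := hξ ▸ Subgroup.mem_zpowers ξ
  obtain ⟨hξr, n, hn⟩ := hξmem
  obtain ⟨k, hk⟩ : ξ ∈ Subgroup.zpowers ζ := hζ ▸ hξr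
  have hk' : ζ ^ k = ξ := hk
  have hmem (r : ℤ) : ζ ^ r ∈ ε.range := hζ ▸ zpow_mem (Subgroup.mem_zpowers ζ) r
  rcases Int.even_or_odd' k with ⟨r, hr | hr⟩
  · exfalso
    have hsq : ξ = (ζ ^ r) ^ 2 := by
      rw [← hk', hr, mul_comm, zpow_mul]
      rfl
    have hη : (ζ ^ r) ^ 2 ^ (n + 1) = 1 := by rw [pow_succ', pow_mul, ← hsq, hn]
    obtain ⟨j, hj⟩ : ζ ^ r ∈ Subgroup.zpowers ξ := hξ ▸ ⟨hmem r, n + 1, hη⟩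
    have hj' : (ζ ^ r) ^ (2 * j - 1) = 1 := by
      rw [zpow_sub_one, mul_inv_eq_one, zpow_mul]
      conv_rhs => rw [← hj]
      rw [hsq]
      rfl
    have h1 : (orderOf (ζ ^ r) : ℤ) ∣ 2 * j - 1 := orderOf_dvd_iff_zpow_eq_one.mpr hj'
    obtain ⟨m, -, hm⟩ := (Nat.dvd_prime_pow Nat.prime_two).mp (orderOf_dvd_of_pow_eq_one hη)
    have h2 : orderOf (ζ ^ r) = 1 := by
      rcases Nat.eq_zero_or_pos m with rfl | hm0
      · simpa using hm
      · exfalso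
        have h3 : (2 : ℤ) ∣ 2 * j - 1 := by
          refine dvd_trans ?_ h1
          rw [hm]
          exact_mod_cast dvd_pow_self 2 hm0.ne'
        lia
    have hξ1 : ξ = 1 := by rw [hsq, orderOf_eq_one_iff.mp h2, one_pow]
    have hneg : (-1 : ℂˣ) ∈ Subgroup.zpowers ξ := hξ ▸ ⟨⟨-1, hε⟩, 1, by norm_num⟩
    rw [hξ1, Subgroup.zpowers_one_eq_bot, Subgroup.mem_bot] at hneg
    have := congrArg Units.val hneg
    norm_num at this
  · obtain ⟨u, hu⟩ := hmem r
    refine ⟨u, ?_⟩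
    rw [hu, ← hk', hr, zpow_add_one, mul_comm 2 r, zpow_mul, mul_comm]
    rfl

/-- For a square root `s` of a generator of the image of `ε`, the degree of `T_g(s)` is here at most
twice the order of `Cl[2]`, so that this field is `selmerField K` and the latter contains `s`. -/
theorem range_le_rootsOfUnity (hK : Module.finrank ℚ K = 2) (hD : discr K = -(D : ℤ))
    (hD4 : 4 < D) (hf : f ≠ ⊥) (hε : ε (-1) = -1) (hχ : HasFiniteType χ ε)
    (hT : Module.finrank K (valueField χ) = classNumber K) :
    ε.range ≤ rootsOfUnity (rootOrder D) ℂ := by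
  obtain ⟨ζ, hζ⟩ := exists_zpowers_eq_range (ε := ε) hf
  obtain ⟨s, hs⟩ := IsAlgClosed.exists_pow_nat_eq (ζ : ℂ) two_pos
  obtain ⟨hpos, hprim⟩ := isPrimitiveRoot_sqrt hf hε hζ hs
  have hh : 0 < classNumber K := Nat.pos_of_ne_zero (classNumber_ne_zero K)
  have hA : 0 < Nat.card (twoTorsionClasses K) := Nat.card_pos
  have hg : Module.finrank K (genusField χ) = Nat.card (twoTorsionClasses K) := by
    have := finrank_valueField_mul hK hD hD4 hf hχ
    rw [hT, mul_comm] at this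
    exact (Nat.eq_of_mul_eq_mul_right hh this).symm
  have hζg : s ^ 2 ∈ genusField χ := by
    obtain ⟨u, hu⟩ : ζ ∈ ε.range := hζ ▸ Subgroup.mem_zpowers ζ
    rw [hs, ← hu]
    exact apply_mem_genusField hχ u
  have hle := selmerField_le_sup hf hχ hζ hs
  have hmem : s ∈ selmerField K := by
    have hsW : s ∈ genusField χ ⊔ IntermediateField.adjoin K {s} :=
      (le_sup_right : IntermediateField.adjoin K {s} ≤ _)
        (IntermediateField.mem_adjoin_simple_self K s)
    by_cases hsg : s ∈ genusField χ
    · exfalso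
      have hW : genusField χ ⊔ IntermediateField.adjoin K {s} = genusField χ :=
        sup_eq_left.mpr (by simpa using hsg)
      rw [hW] at hle
      have : FiniteDimensional K (genusField χ) :=
        Module.finite_of_finrank_pos (by rw [hg]; exact hA)
      have h1 := IntermediateField.finrank_le_of_le_right hle
      rw [finrank_selmerField hK hD hD4, hg] at h1
      lia
    · have hW := finrank_sup_adjoin_sqrt (genusField χ) hζg hsg
      have : FiniteDimensional K ↥(genusField χ ⊔ IntermediateField.adjoin K {s}) :=
        Module.finite_of_finrank_pos (by rw [hW, hg]; exact Nat.mul_pos hA two_pos)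
      rw [IntermediateField.eq_of_le_of_finrank_le hle
        (by rw [hW, hg, finrank_selmerField hK hD hD4, mul_comm])]
      exact hsW
  have hdvd := dvd_rootOrder_of_mem_selmerField hK hD hD4 hpos hprim hmem
  rw [← hζ, Subgroup.zpowers_le, mem_rootsOfUnity]
  exact orderOf_dvd_iff_pow_eq_one.mp hdvd

/-- The condition on the image of `ε` puts the square root `s` of a generator into `selmerField K`,
so that `T_g(s) = selmerField K` has degree twice the order of `Cl[2]`. -/
theorem finrank_valueField_of_range_le (hK : Module.finrank ℚ K = 2) (hD : discr K = -(D : ℤ))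
    (hD4 : 4 < D) (hf : f ≠ ⊥) (hχ : HasFiniteType χ ε)
    (hle : ε.range ≤ rootsOfUnity (rootOrder D) ℂ) {ζ : ℂˣ}
    (hζ : Subgroup.zpowers ζ = ε.range) {s : ℂ} (hs : s ^ 2 = ζ) :
    (s ∉ genusField χ → Module.finrank K (valueField χ) = classNumber K) ∧
    (s ∈ genusField χ → Module.finrank K (valueField χ) = 2 * classNumber K) := by
  have hA : 0 < Nat.card (twoTorsionClasses K) := Nat.card_pos
  have hζr : ζ ∈ ε.range := hζ ▸ Subgroup.mem_zpowers ζ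
  have hζg : s ^ 2 ∈ genusField χ := by
    obtain ⟨u, hu⟩ := hζr
    rw [hs, ← hu]
    exact apply_mem_genusField hχ u
  have hmem : s ∈ selmerField K := by
    refine mem_selmerField_of_pow_rootOrder_eq_one hK hD ?_
    rw [pow_mul, hs, ← Units.val_pow_eq_pow_val, (mem_rootsOfUnity _ _).mp (hle hζr),
      Units.val_one]
  have hW : genusField χ ⊔ IntermediateField.adjoin K {s} = selmerField K :=
    le_antisymm (sup_le_selmerField hf hχ hζ hs hmem) (selmerField_le_sup hf hχ hζ hs)
  have hM := finrank_selmerField hK hD hD4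
  have hT := finrank_valueField_mul hK hD hD4 hf hχ
  constructor
  · intro hsg
    have h := finrank_sup_adjoin_sqrt (genusField χ) hζg hsg
    rw [hW, hM, mul_comm] at h
    rw [← Nat.eq_of_mul_eq_mul_right two_pos h, mul_comm] at hT
    exact Nat.eq_of_mul_eq_mul_left hA hT
  · intro hsg
    rw [sup_eq_left.mpr (by simpa using hsg)] at hW
    rw [hW, hM, mul_comm, mul_comm 2, mul_assoc] at hT
    exact Nat.eq_of_mul_eq_mul_left hA hT

end

end

end CMHecke

theorem theorem3p4 (K : Type*) [Field K] [NumberField K] [NumberField.IsTotallyComplex K]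
    [Algebra K ℂ] (hK : Module.finrank ℚ K = 2)
    (D : ℕ) (hD : NumberField.discr K = -(D : ℤ)) (hD4 : 4 < D)
    (f : Ideal (NumberField.RingOfIntegers K)) (hf : f ≠ ⊥)
    (ε : (NumberField.RingOfIntegers K ⧸ f)ˣ →* ℂˣ) (hε : ε (-1) = -1)
    (Φ : (K →+* ℂ) → ℤ) (χ : CMHecke.AlgebraicHeckeCharacter K f Φ)
    (hχ : CMHecke.HasFiniteType χ ε) :
    (Module.finrank K (CMHecke.valueField χ) = NumberField.classNumber K →
      ε.range ≤ rootsOfUnity (CMHecke.rootOrder D) ℂ) ∧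
    (ε.range ≤ rootsOfUnity (CMHecke.rootOrder D) ℂ →
      (Module.finrank K (CMHecke.valueField χ) = NumberField.classNumber K ∨
        Module.finrank K (CMHecke.valueField χ) = 2 * NumberField.classNumber K) ∧
      ∀ ξ : ℂˣ, Subgroup.zpowers ξ = CMHecke.muPrimary 2 ε →
        (Module.finrank K (CMHecke.valueField χ) = NumberField.classNumber K ↔
          ∀ s : ℂ, s ^ 2 = (ξ : ℂ) → s ∉ CMHecke.genusField χ)) ∧
    (∀ (Φ' : (K →+* ℂ) → ℤ) (χ' : CMHecke.AlgebraicHeckeCharacter K f Φ'),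
      CMHecke.HasFiniteType χ' ε →
      (Module.finrank K (CMHecke.valueField χ) = NumberField.classNumber K ↔
        Module.finrank K (CMHecke.valueField χ') = NumberField.classNumber K)) := by
  refine ⟨CMHecke.range_le_rootsOfUnity hK hD hD4 hf hε hχ, fun hle => ?_, fun Φ' χ' hχ' => ?_⟩
  · obtain ⟨ζ, hζ⟩ := CMHecke.exists_zpowers_eq_range (ε := ε) hf
    obtain ⟨s, hs⟩ := IsAlgClosed.exists_pow_nat_eq (ζ : ℂ) two_pos
    obtain ⟨h1, h2⟩ := CMHecke.finrank_valueField_of_range_le hK hD hD4 hf hχ hle hζ hs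
    have hh := NumberField.classNumber_ne_zero K
    have hiff : Module.finrank K (CMHecke.valueField χ) = NumberField.classNumber K ↔
        s ∉ CMHecke.genusField χ :=
      ⟨fun h hsg => by have := h2 hsg; lia, h1⟩
    refine ⟨?_, fun ξ hξ => hiff.trans ?_⟩
    · by_cases hsg : s ∈ CMHecke.genusField χ
      · exact Or.inr (h2 hsg)
      · exact Or.inl (h1 hsg)
    · -- The square roots of `ξ` and of `ζ` differ by values of `ε`, which lie in `T_g`.
      obtain ⟨u, hu⟩ := CMHecke.exists_eq_mul_sq hε hζ hξ
      have huξ : (ξ : ℂ) = (s * ε u) ^ 2 := by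
        rw [hu, Units.val_mul, Units.val_pow_eq_pow_val, ← hs, mul_pow]
      have hug := CMHecke.apply_mem_genusField hχ u
      have hsu : s * ε u ∈ CMHecke.genusField χ ↔ s ∈ CMHecke.genusField χ := by
        refine ⟨fun h => ?_, fun h => mul_mem h hug⟩
        rw [← mul_div_cancel_right₀ s (ε u).ne_zero]
        exact div_mem h hug
      refine ⟨fun hsg s' hs' hsg' => hsg (hsu.mp ?_), fun h hsg => h _ huξ.symm (hsu.mpr hsg)⟩
      rcases sq_eq_sq_iff_eq_or_eq_neg.mp (hs'.trans huξ) with h | h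
      · exact h ▸ hsg'
      · rw [← neg_neg (s * (ε u : ℂ)), ← h]
        exact neg_mem hsg'
  · have hg : CMHecke.genusField χ = CMHecke.genusField χ' :=
      le_antisymm (CMHecke.genusField_le_genusField hf hχ hχ')
        (CMHecke.genusField_le_genusField hf hχ' hχ)
    have h1 := CMHecke.finrank_valueField_mul hK hD hD4 hf hχ
    have h2 := CMHecke.finrank_valueField_mul hK hD hD4 hf hχ'
    rw [hg, ← h2] at h1
    rw [Nat.eq_of_mul_eq_mul_right Nat.card_pos h1]
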